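/- Let $n,m,r\ge 1$ be natural numbers and let $f_a:\mathbb{R}^{n\times m}\to\mathbb{R}$ be twice continuously differentiable. Suppose that $f_a$ satisfies the $\delta$-RIP$_{2r,2r}$ property with $0\le\delta<1/3$, that is, $$(1-\delta)\|K\|_F^2\le[\nabla^2 f_a(M)](K,K)\le(1+\delta)\|K\|_F^2$$ for all $M,K\in\mathbb{R}^{n\times m}$ with $\operatorname{rank}(M)\le 2r$ and $\operatorname{rank}(K)\le 2r$. Let $M_a^*$ be a critical point of $f_a$, $\nabla f_a(M_a^*)=0$, with $\operatorname{rank}(M_a^*)=r$ (it is then the global optimum of $f_a$ over the matrices of rank at most $r$). Let $\alpha>0$ be arbitrary and let $\mu\in[(1-\delta)/3,\,1-\delta)$. Consider the regularized problem $$\min_{U\in\mathbb{R}^{n\times r},\,V\in\mathbb{R}^{m\times r}}\ \rho(U,V):=f_a(UV^T)+\frac{\mu}{4}\|U^TU-V^TV\|_F^2 ,$$ and let $\mathcal{X}^*$ be the set of its global minima. Then there exist positive constants $$\epsilon_1=\epsilon_1(\delta,r,\mu,\sigma_r(M_a^*),\|M_a^*\|_F,\alpha),\qquad \lambda_1=\lambda_1(\delta,r,\mu,\sigma_r(M_a^*),\|M_a^*\|_F,\alpha),$$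 depending only on the listed quantities (where $\sigma_r$ denotes the $r$-th largest singular value), such that for every $\epsilon\in(0,\epsilon_1]$ and every $\lambda\in(0,\lambda_1]$ the regularized problem satisfies the $(\alpha,\beta,\gamma)$-strict saddle property with $$\beta:=\min\{\mu(\epsilon/r)^{3/2},\lambda\}>0,\qquad \gamma:=\mu\epsilon>0,$$ that is, for every $W=(U,V)\in\mathbb{R}^{n\times r}\times\mathbb{R}^{m\times r}$ at least one of the following holds: $$\operatorname{dist}(W,\mathcal{X}^*)\le\alpha;\qquad \|\nabla\rho(W)\|_F\ge\beta;\qquad \lambda_{\min}[\nabla^2\rho(W)]\le-\gamma ,$$ where $\operatorname{dist}$ is the distance in the Frobenius norm $(\|U\|_F^2+\|V\|_F^2)^{1/2}$ (and is infinite if $\mathcal{X}^*=\emptyset$). -/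

import Mathlib

attribute [local instance] Matrix.frobeniusNormedAddCommGroup Matrix.frobeniusNormedSpace

noncomputable section

/-! ### Smooth optimization problems and the strict saddle property -/

section Calculus

variable {E : Type*} [NormedAddCommGroup E] [NormedSpace ℝ E]

/-- `x` is a first-order critical point of `f`. -/
def IsCriticalPoint (f : E → ℝ) (x : E) : Prop := fderiv ℝ f x = 0

/-- The quadratic form `[∇² f(x)](v, v)`. -/
def curvature (f : E → ℝ) (x v : E) : ℝ := fderiv ℝ (fderiv ℝ f) x v v

end Calculus

section Optimization

variable {E : Type*} [NormedAddCommGroup E] [InnerProductSpace ℝ E] [CompleteSpace E]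

/-- The Hessian of `F` at `x`, as the derivative of the gradient. -/
def hessian (F : E → ℝ) (x : E) : E →L[ℝ] E := fderiv ℝ (gradient F) x

/-- The smallest eigenvalue `λ_min` of an operator on a finite-dimensional space. -/
def minEigenvalue (T : E →L[ℝ] E) : ℝ :=
  sInf {c : ℝ | Module.End.HasEigenvalue (T : E →ₗ[ℝ] E) c}

/-- The set of global minima of the problem of minimizing `F` over `X`. -/
def globalMinima (X : Set E) (F : E → ℝ) : Set E := {x | x ∈ X ∧ ∀ y ∈ X, F x ≤ F y}

/-- The `(α, β, γ)`-strict saddle property of the problem of minimizing `F` over `X`.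
The distance is extended, so that the distance to an empty set of minima is infinite. -/
def StrictSaddle (X : Set E) (F : E → ℝ) (α β γ : ℝ) : Prop :=
  0 < α ∧ 0 < β ∧ 0 < γ ∧
    ∀ x ∈ X, Metric.infEDist x (globalMinima X F) ≤ ENNReal.ofReal α ∨
      β ≤ ‖gradient F x‖ ∨ minEigenvalue (hessian F x) ≤ -γ

end Optimization

/-! ### Low-rank matrix problems -/

/-- The restricted isometry property of rank `(2r, 2t)` with constant `δ`; the norm is the
Frobenius norm. -/
def RIP {n m : ℕ} (f : Matrix (Fin n) (Fin m) ℝ → ℝ) (r t : ℕ) (δ : ℝ) : Prop :=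
  0 ≤ δ ∧ δ < 1 ∧
    ∀ M K : Matrix (Fin n) (Fin m) ℝ, M.rank ≤ 2 * r → K.rank ≤ 2 * t →
      (1 - δ) * ‖K‖ ^ 2 ≤ curvature f M K ∧ curvature f M K ≤ (1 + δ) * ‖K‖ ^ 2

/-- The singular value `σ_k(M)`, where `k = 1` is the index of the largest one. -/
def sigma {n m : ℕ} (k : ℕ) (M : Matrix (Fin n) (Fin m) ℝ) : ℝ :=
  (Matrix.toEuclideanLin M).singularValues (k - 1)

/-- The space of pairs `(U, V)` of an `n × r` and an `m × r` matrix, written as one stacked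
matrix `W`. Its Euclidean norm is the Frobenius norm `(‖U‖_F² + ‖V‖_F²)^(1/2)`. -/
abbrev FactorSpace (n m r : ℕ) : Type := EuclideanSpace ℝ ((Fin n ⊕ Fin m) × Fin r)

/-- The block `U` of `W`. -/
def upper {n m r : ℕ} (W : FactorSpace n m r) : Matrix (Fin n) (Fin r) ℝ :=
  Matrix.of fun i k => W (Sum.inl i, k)

/-- The block `V` of `W`. -/
def lower {n m r : ℕ} (W : FactorSpace n m r) : Matrix (Fin m) (Fin r) ℝ :=
  Matrix.of fun j k => W (Sum.inr j, k)

/-- The regularized objective `ρ(U, V) = f(U Vᵀ) + (μ / 4) ‖Uᵀ U - Vᵀ V‖_F²`. -/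
def rho {n m : ℕ} (r : ℕ) (f : Matrix (Fin n) (Fin m) ℝ → ℝ) (μ : ℝ) (W : FactorSpace n m r) : ℝ :=
  f (upper W * (lower W).transpose) +
    μ / 4 * ‖(upper W).transpose * upper W - (lower W).transpose * lower W‖ ^ 2

end

/-! Everything reduces to one uniform statement: some g > 0, depending only on δ, r, μ, ‖M*‖ and α,
is such that ‖∇ρ(W)‖ < g and λ_min(∇²ρ(W)) > -g force W to lie within α of a global minimum
(`exists_uniform_strict_saddle`). Then λ₁ = g and ε₁ = g/μ work, since β ≤ λ and γ = με.

Write M = UVᵀ, N = M*, D = ‖M - N‖², Δ = UᵀU - VᵀV and φ = ∇f(M). Strong convexity along the segment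
from N to M gives (1-δ)D ≤ φ(M) - φ(N). A small gradient bounds U and V a priori and makes Δ and
φ(M) small, so the task is to bound -φ(N) from above. Take a unit z minimizing s = ‖Uz‖² + ‖Vz‖²;
curvature in the directions (xzᵀ, yzᵀ) bounds -φ(xyᵀ) (`second_order_test`).

If s is small, this makes -φ small on every unit rank-one matrix, hence -φ(N) is small
(`neg_apply_le_of_small_singular_value`). Otherwise U and V are well conditioned. Up to terms on
which φ is small, N is then its compression Z orthogonal to the ranges of U and V, and -φ(Z) is at
most about (1+δ)s/2 times the nuclear norm T of Z. A lower bound of Eckart–Young type gives 2aT ≤ D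
with 2a close to s (`neg_apply_le_of_large_singular_value`). Together (1-δ)D ≤ (1+δ)D/2 + small,
that is (1-3δ)D/2 ≤ small, and δ < 1/3 makes D small.

Finally a Procrustes estimate turns smallness of D and Δ into closeness of W to a rotated balanced
factorization of N, which is a global minimum. -/

section LinearAlgebraAndCalculus

open Matrix

/-! ### Frobenius inner product. -/

section Frobenius

variable {l m n k : Type*} [Fintype l] [Fintype m] [Fintype n] [Fintype k]

/-- The Frobenius inner product of two real matrices. -/
def frobInner (A B : Matrix m n ℝ) : ℝ := trace (Aᵀ * B)

theorem frobInner_eq_sum (A B : Matrix m n ℝ) :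
    frobInner A B = ∑ j, ∑ i, A i j * B i j := by
  simp [frobInner, trace, mul_apply]

theorem norm_sq_eq_frobInner (A : Matrix m n ℝ) : ‖A‖ ^ 2 = frobInner A A := by
  rw [frobenius_norm_def, frobInner_eq_sum, Finset.sum_comm, ← Real.sqrt_eq_rpow, Real.sq_sqrt]
  · simp [← pow_two]
  · positivity

theorem frobInner_comm (A B : Matrix m n ℝ) : frobInner A B = frobInner B A := by
  simp [frobInner_eq_sum, mul_comm]

theorem frobInner_add_left (A B C : Matrix m n ℝ) :
    frobInner (A + B) C = frobInner A C + frobInner B C := by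
  simp [frobInner, Matrix.add_mul]

theorem frobInner_add_right (A B C : Matrix m n ℝ) :
    frobInner A (B + C) = frobInner A B + frobInner A C := by
  simp [frobInner, Matrix.mul_add]

theorem frobInner_sub_left (A B C : Matrix m n ℝ) :
    frobInner (A - B) C = frobInner A C - frobInner B C := by
  simp [frobInner, Matrix.sub_mul]

theorem frobInner_sub_right (A B C : Matrix m n ℝ) :
    frobInner A (B - C) = frobInner A B - frobInner A C := by
  simp [frobInner, Matrix.mul_sub]

theorem frobInner_smul_left (a : ℝ) (A B : Matrix m n ℝ) :
    frobInner (a • A) B = a * frobInner A B := by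
  simp [frobInner]

theorem frobInner_smul_right (a : ℝ) (A B : Matrix m n ℝ) :
    frobInner A (a • B) = a * frobInner A B := by
  simp [frobInner]

theorem frobInner_zero_right (A : Matrix m n ℝ) : frobInner A 0 = 0 := by
  simp [frobInner]

theorem frobInner_mul_left (A : Matrix m n ℝ) (B : Matrix n k ℝ) (C : Matrix m k ℝ) :
    frobInner (A * B) C = frobInner B (Aᵀ * C) := by
  simp [frobInner, Matrix.mul_assoc]

theorem frobInner_mul_right (A : Matrix m n ℝ) (B : Matrix n k ℝ) (C : Matrix m k ℝ) :
    frobInner (A * B) C = frobInner A (C * Bᵀ) := by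
  rw [frobInner, frobInner, transpose_mul, Matrix.mul_assoc, trace_mul_comm, Matrix.mul_assoc]

theorem frobInner_transpose (A B : Matrix m n ℝ) : frobInner Aᵀ Bᵀ = frobInner A B := by
  rw [frobInner, frobInner, transpose_transpose, ← trace_transpose, transpose_mul,
    transpose_transpose, trace_mul_comm]

theorem abs_frobInner_le (A B : Matrix m n ℝ) : |frobInner A B| ≤ ‖A‖ * ‖B‖ := by
  have h := Finset.sum_mul_sq_le_sq_mul_sq (Finset.univ : Finset (n × m))
    (fun p => A p.2 p.1) (fun p => B p.2 p.1)
  simp only [Fintype.sum_prod_type] at h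
  rw [← frobInner_eq_sum] at h
  simp only [pow_two (A _ _), pow_two (B _ _)] at h
  rw [← frobInner_eq_sum, ← frobInner_eq_sum, ← norm_sq_eq_frobInner, ← norm_sq_eq_frobInner,
    ← mul_pow] at h
  exact abs_le_of_sq_le_sq h (by positivity)

theorem norm_sq_add_frob (A B : Matrix m n ℝ) :
    ‖A + B‖ ^ 2 = ‖A‖ ^ 2 + 2 * frobInner A B + ‖B‖ ^ 2 := by
  simp only [norm_sq_eq_frobInner, frobInner_add_left, frobInner_add_right, frobInner_comm B A]
  ring

theorem norm_sq_sub_frob (A B : Matrix m n ℝ) :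
    ‖A - B‖ ^ 2 = ‖A‖ ^ 2 - 2 * frobInner A B + ‖B‖ ^ 2 := by
  simp only [norm_sq_eq_frobInner, frobInner_sub_left, frobInner_sub_right, frobInner_comm B A]
  ring

theorem norm_sq_mul_of_orthonormal [DecidableEq k] {P : Matrix m k ℝ} (hP : Pᵀ * P = 1)
    (A : Matrix k n ℝ) : ‖P * A‖ ^ 2 = ‖A‖ ^ 2 := by
  rw [norm_sq_eq_frobInner, norm_sq_eq_frobInner, frobInner_mul_left, ← Matrix.mul_assoc, hP,
    Matrix.one_mul]

theorem norm_sq_of_orthonormal [DecidableEq k] {P : Matrix m k ℝ} (hP : Pᵀ * P = 1) :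
    ‖P‖ ^ 2 = Fintype.card k := by
  rw [norm_sq_eq_frobInner, frobInner, hP, trace_one]

theorem norm_sq_mul_le_of_orthonormal [DecidableEq k] {P : Matrix n k ℝ} (hP : Pᵀ * P = 1)
    (A : Matrix m n ℝ) : ‖A * P‖ ^ 2 ≤ ‖A‖ ^ 2 := by
  have h := sq_nonneg ‖A - A * P * Pᵀ‖
  rw [norm_sq_sub_frob, frobInner_comm, frobInner_mul_right, transpose_transpose,
    ← norm_sq_eq_frobInner, norm_sq_eq_frobInner (A * P * Pᵀ), frobInner_mul_right,
    transpose_transpose, Matrix.mul_assoc (A * P), hP, Matrix.mul_one,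
    ← norm_sq_eq_frobInner] at h
  linarith

theorem trace_sq_le (A : Matrix n n ℝ) : trace A ^ 2 ≤ Fintype.card n * ‖A‖ ^ 2 := by
  classical
  have h := abs_frobInner_le (1 : Matrix n n ℝ) A
  have h1 : ‖(1 : Matrix n n ℝ)‖ ^ 2 = Fintype.card n := norm_sq_of_orthonormal (by simp)
  rw [frobInner, transpose_one, Matrix.one_mul] at h
  calc trace A ^ 2 = |trace A| ^ 2 := (sq_abs _).symm
    _ ≤ (‖(1 : Matrix n n ℝ)‖ * ‖A‖) ^ 2 := by gcongr
    _ = _ := by rw [mul_pow, h1]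

theorem norm_sq_eq_sum_col (A : Matrix m n ℝ) :
    ‖A‖ ^ 2 = ∑ j, ‖replicateCol Unit (A.col j)‖ ^ 2 := by
  simp only [norm_sq_eq_frobInner, frobInner_eq_sum]
  simp

omit [Fintype l] [Fintype n] in
theorem mul_replicateCol_col (A : Matrix l m ℝ) (B : Matrix m n ℝ) (j : n) :
    A * replicateCol Unit (B.col j) = replicateCol Unit ((A * B).col j) := by
  ext i u
  simp [mul_apply]

end Frobenius

/-! ### Singular value decompositions and balanced factorizations. -/

section SVD

variable {m n : Type*} [Fintype m] [Fintype n] [DecidableEq m] [DecidableEq n]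

omit [Fintype m] [DecidableEq m] in
theorem Matrix.PosSemidef.exists_orthogonal_diagonalization {S : Matrix n n ℝ}
    (hS : S.PosSemidef) :
    ∃ (O : Matrix n n ℝ) (d : n → ℝ), Oᵀ * O = 1 ∧ O * Oᵀ = 1 ∧ (∀ i, 0 ≤ d i) ∧
      S = O * diagonal d * Oᵀ := by
  have hO := (Matrix.mem_unitaryGroup_iff').1 hS.1.eigenvectorUnitary.2
  have hO' := (Matrix.mem_unitaryGroup_iff).1 hS.1.eigenvectorUnitary.2
  have h := hS.1.spectral_theorem
  rw [Unitary.conjStarAlgAut_apply] at h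
  rw [star_eq_conjTranspose, conjTranspose_eq_transpose_of_trivial] at hO hO' h
  exact ⟨hS.1.eigenvectorUnitary, hS.1.eigenvalues, hO, hO', hS.eigenvalues_nonneg, h⟩

omit [DecidableEq m] in
-- Diagonalizing MᵀM makes the columns of MO orthogonal; both decompositions below come from
-- normalizing the nonzero ones.
theorem exists_orthogonal_gram_eq_diagonal (M : Matrix m n ℝ) :
    ∃ (O : Matrix n n ℝ) (d : n → ℝ), Oᵀ * O = 1 ∧ O * Oᵀ = 1 ∧ (∀ i, 0 ≤ d i) ∧
      (M * O)ᵀ * (M * O) = diagonal d := by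
  have hS : (Mᵀ * M).PosSemidef := by
    simpa using posSemidef_conjTranspose_mul_self M
  obtain ⟨O, d, hO, hO', hd, h⟩ := hS.exists_orthogonal_diagonalization
  refine ⟨O, d, hO, hO', hd, ?_⟩
  rw [transpose_mul, Matrix.mul_assoc, ← Matrix.mul_assoc Mᵀ, h, Matrix.mul_assoc,
    Matrix.mul_assoc, hO, Matrix.mul_one, ← Matrix.mul_assoc, hO, Matrix.one_mul]

omit [DecidableEq m] in
theorem exists_svd (M : Matrix m n ℝ) :
    ∃ (k : ℕ) (P : Matrix m (Fin k) ℝ) (Q : Matrix n (Fin k) ℝ) (τ : Fin k → ℝ),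
      k ≤ M.rank ∧ (∀ i, 0 < τ i) ∧ Pᵀ * P = 1 ∧ Qᵀ * Q = 1 ∧ M = P * diagonal τ * Qᵀ := by
  obtain ⟨O, d, hO, hO', hd, hN⟩ := exists_orthogonal_gram_eq_diagonal M
  set N := M * O with hNdef
  have hM : M = N * Oᵀ := by rw [hNdef, Matrix.mul_assoc, hO', Matrix.mul_one]
  have hNij : ∀ i j, ∑ a, N a i * N a j = if i = j then d i else 0 := by
    intro i j
    have := congrFun (congrFun hN i) j
    simpa [mul_apply, diagonal_apply] using this
  have hOij : ∀ i j, ∑ a, O a i * O a j = if i = j then 1 else 0 := by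
    intro i j
    have := congrFun (congrFun hO i) j
    simpa [mul_apply, one_apply] using this
  have hzero : ∀ j, d j = 0 → ∀ a, N a j = 0 := by
    intro j hj a
    have h := hNij j j
    rw [if_pos rfl, hj, Finset.sum_eq_zero_iff_of_nonneg (fun a _ => mul_self_nonneg _)] at h
    exact mul_self_eq_zero.1 (h a (Finset.mem_univ a))
  let e := Fintype.equivFin {j // d j ≠ 0}
  let σ : Fin (Fintype.card {j // d j ≠ 0}) → n := fun i => (e.symm i).1
  have hσ : ∀ i, d (σ i) ≠ 0 := fun i => (e.symm i).2
  have hσinj : Function.Injective σ := Subtype.val_injective.comp e.symm.injective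
  have hτ : ∀ i, 0 < √(d (σ i)) := fun i =>
    Real.sqrt_pos.2 (lt_of_le_of_ne (hd _) (Ne.symm (hσ i)))
  have hPP : (of fun a i => N a (σ i) / √(d (σ i)) : Matrix m _ ℝ)ᵀ *
      (of fun a i => N a (σ i) / √(d (σ i))) = 1 := by
    ext i j
    simp only [mul_apply, transpose_apply, of_apply, one_apply]
    have : ∀ a, N a (σ i) / √(d (σ i)) * (N a (σ j) / √(d (σ j))) =
        (N a (σ i) * N a (σ j)) / (√(d (σ i)) * √(d (σ j))) := fun a => by
      rw [div_mul_div_comm]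
    simp only [this, ← Finset.sum_div, hNij, hσinj.eq_iff]
    split_ifs with h
    · subst h
      rw [Real.mul_self_sqrt (hd _), div_self (hσ i)]
    · simp
  have hQQ : (of fun a i => O a (σ i) : Matrix n _ ℝ)ᵀ * (of fun a i => O a (σ i)) = 1 := by
    ext i j
    simp only [mul_apply, transpose_apply, of_apply, one_apply, hOij, hσinj.eq_iff]
  have hfac : M = (of fun a i => N a (σ i) / √(d (σ i))) * diagonal (fun i => √(d (σ i))) *
      (of fun a i => O a (σ i) : Matrix n _ ℝ)ᵀ := by
    ext a b
    rw [hM, mul_apply, mul_apply]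
    symm
    apply Finset.sum_of_injOn σ hσinj.injOn (by simp)
    · intro j _ hj
      have : d j = 0 := by
        by_contra h
        exact hj ⟨e ⟨j, h⟩, by simp, by simp [σ]⟩
      rw [hzero j this, zero_mul]
    · intro i _
      rw [mul_diagonal, of_apply, div_mul_cancel₀ _ (hτ i).ne']
      rfl
  -- The rank bound: diag τ = PᵀMQ is invertible of size k, so k ≤ rank M.
  refine ⟨_, _, _, _, ?_, hτ, hPP, hQQ, hfac⟩
  generalize (of fun a i => N a (σ i) / √(d (σ i)) : Matrix m _ ℝ) = P at *
  generalize (of fun a i => O a (σ i) : Matrix n _ ℝ) = Q at *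
  have h2 : diagonal (fun i => √(d (σ i))) = Pᵀ * (M * Q) := by
    conv_rhs => rw [hfac]
    rw [Matrix.mul_assoc, hQQ, Matrix.mul_one, ← Matrix.mul_assoc, hPP, Matrix.one_mul]
  have h3 : (diagonal (fun i => √(d (σ i)))).rank = Fintype.card {j // d j ≠ 0} := by
    rw [rank_diagonal]
    simp [fun i => (hτ i).ne']
  calc _ = (Pᵀ * (M * Q)).rank := h3.symm.trans (congrArg _ h2)
    _ ≤ (M * Q).rank := rank_mul_le_right _ _
    _ ≤ M.rank := rank_mul_le_left _ _

theorem exists_svd_square (B : Matrix n n ℝ) :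
    ∃ (P Q : Matrix n n ℝ) (d : n → ℝ), Pᵀ * P = 1 ∧ P * Pᵀ = 1 ∧ Qᵀ * Q = 1 ∧ Q * Qᵀ = 1 ∧
      (∀ i, 0 ≤ d i) ∧ B = P * diagonal d * Qᵀ := by
  obtain ⟨O, d, hO, hO', hd, hN⟩ := exists_orthogonal_gram_eq_diagonal B
  set N := B * O with hNdef
  have hB : B = N * Oᵀ := by rw [hNdef, Matrix.mul_assoc, hO', Matrix.mul_one]
  have hNij : ∀ i j, ∑ a, N a i * N a j = if i = j then d i else 0 := by
    intro i j
    have := congrFun (congrFun hN i) j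
    simpa [mul_apply, diagonal_apply] using this
  have hzero : ∀ j, d j = 0 → ∀ a, N a j = 0 := by
    intro j hj a
    have h := hNij j j
    rw [if_pos rfl, hj, Finset.sum_eq_zero_iff_of_nonneg (fun a _ => mul_self_nonneg _)] at h
    exact mul_self_eq_zero.1 (h a (Finset.mem_univ a))
  let v : n → EuclideanSpace ℝ n := fun j => WithLp.toLp 2 fun a => N a j / √(d j)
  have hv : Orthonormal ℝ (Set.domRestrict {j | d j ≠ 0} v) := by
    rw [orthonormal_iff_ite]
    rintro ⟨i, hi⟩ ⟨j, hj⟩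
    have : ∀ a, N a j / √(d j) * (N a i / √(d i)) = (N a i * N a j) / (√(d i) * √(d j)) :=
      fun a => by rw [div_mul_div_comm, mul_comm (N a j), mul_comm (√(d j))]
    simp only [Set.domRestrict_apply, v, PiLp.inner_apply, RCLike.inner_apply, conj_trivial, this,
      ← Finset.sum_div, hNij, Subtype.mk.injEq]
    split_ifs with h
    · subst h
      rw [Real.mul_self_sqrt (hd _), div_self hi]
    · simp
  obtain ⟨b, hb⟩ := hv.exists_orthonormalBasis_extension_of_card_eq (by simp)
  have hbb : (of fun a j => b j a : Matrix n n ℝ)ᵀ * (of fun a j => b j a) = 1 := by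
    ext i j
    have := orthonormal_iff_ite.1 b.orthonormal i j
    simp only [PiLp.inner_apply, RCLike.inner_apply, conj_trivial] at this
    simp only [mul_apply, transpose_apply, of_apply, one_apply]
    rw [← this]
    exact Finset.sum_congr rfl fun a _ => mul_comm _ _
  refine ⟨of fun a j => b j a, O, fun j => √(d j), hbb, mul_eq_one_comm.1 hbb, hO, hO',
    fun i => Real.sqrt_nonneg _, ?_⟩
  rw [hB]
  congr 1
  ext a j
  rw [mul_diagonal, of_apply]
  by_cases h : d j = 0
  · rw [hzero j h, h, Real.sqrt_zero, mul_zero]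
  · rw [hb j h]
    exact (div_mul_cancel₀ _ (Real.sqrt_pos.2 (lt_of_le_of_ne (hd _) (Ne.symm h))).ne').symm

/-- Polar decomposition: if B = P diag(d) Qᵀ, take R = QPᵀ, so that BR = P diag(d) Pᵀ. -/
theorem exists_orthogonal_mul_posSemidef (B : Matrix n n ℝ) :
    ∃ R : Matrix n n ℝ, Rᵀ * R = 1 ∧ R * Rᵀ = 1 ∧ (B * R).PosSemidef := by
  obtain ⟨P, Q, d, hP, hP', hQ, hQ', hd, rfl⟩ := exists_svd_square B
  refine ⟨Q * Pᵀ, ?_, ?_, ?_⟩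
  · rw [transpose_mul, transpose_transpose, Matrix.mul_assoc, ← Matrix.mul_assoc Qᵀ, hQ,
      Matrix.one_mul, hP']
  · rw [transpose_mul, transpose_transpose, Matrix.mul_assoc, ← Matrix.mul_assoc Pᵀ, hP,
      Matrix.one_mul, hQ']
  · have : P * diagonal d * Qᵀ * (Q * Pᵀ) = P * diagonal d * Pᴴ := by
      rw [Matrix.mul_assoc, ← Matrix.mul_assoc Qᵀ, hQ, Matrix.one_mul,
        conjTranspose_eq_transpose_of_trivial]
    rw [this]
    exact (PosSemidef.diagonal hd).mul_mul_conjTranspose_same P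

omit [DecidableEq m] in
theorem exists_balanced_factorization {r : ℕ} (M : Matrix m n ℝ) (hM : M.rank ≤ r) :
    ∃ (X : Matrix m (Fin r) ℝ) (Y : Matrix n (Fin r) ℝ), X * Yᵀ = M ∧ Xᵀ * X = Yᵀ * Y := by
  obtain ⟨k, P, Q, τ, hk, hτ, hP, hQ, rfl⟩ := exists_svd M
  -- `E` pads the k columns with zero columns up to r, as the rank may be less than r.
  let E : Matrix (Fin k) (Fin r) ℝ := of fun i j => if j = Fin.castLE (hk.trans hM) i then 1 else 0
  have hE : E * Eᵀ = 1 := by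
    ext i j
    simp [E, mul_apply, one_apply, eq_comm]
  let S : Matrix (Fin k) (Fin k) ℝ := diagonal fun i => √(τ i)
  have hS : Sᵀ = S := diagonal_transpose _
  have hSS : S * S = diagonal τ := by
    simp only [S, diagonal_mul_diagonal, fun i => Real.mul_self_sqrt (hτ i).le]
  refine ⟨P * S * E, Q * S * E, ?_, ?_⟩
  · rw [transpose_mul, transpose_mul, hS, Matrix.mul_assoc, ← Matrix.mul_assoc E, hE,
      Matrix.one_mul, Matrix.mul_assoc, ← Matrix.mul_assoc S, hSS, Matrix.mul_assoc]
  · simp only [transpose_mul, hS, Matrix.mul_assoc]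
    rw [← Matrix.mul_assoc Pᵀ, hP, ← Matrix.mul_assoc Qᵀ, hQ]

end SVD

/-! ### Ridge projections and well-conditioned factors. -/

section Projection

variable {m n k : Type*} [Fintype m] [Fintype n] [Fintype k]

/-- Ridge regression with B = (UᵀU + tI)⁻¹UᵀX. With t = 0 it is the orthogonal projection onto the
range of U; with t > 0 it needs no conditioning of U, and the residual is only nearly orthogonal to
U. -/
theorem exists_regularized_projection (U : Matrix m n ℝ) (X : Matrix m k ℝ) {t a : ℝ} (ha : 0 < a)
    (hU : ∀ y : Matrix n Unit ℝ, a * ‖y‖ ^ 2 ≤ ‖U * y‖ ^ 2 + t * ‖y‖ ^ 2) :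
    ∃ (B : Matrix n k ℝ) (X₂ : Matrix m k ℝ), X = U * B + X₂ ∧ Uᵀ * X₂ = t • B ∧
      ‖X‖ ^ 2 = ‖X₂‖ ^ 2 + 2 * t * ‖B‖ ^ 2 + ‖U * B‖ ^ 2 := by
  classical
  set S := Uᵀ * U + t • (1 : Matrix n n ℝ) with hS
  have hdet : IsUnit S.det := by
    rw [isUnit_iff_ne_zero]
    intro h0
    obtain ⟨v, hv, hSv⟩ := exists_mulVec_eq_zero_iff.2 h0
    have h1 : S * replicateCol Unit v = 0 := by
      rw [← replicateCol_mulVec, hSv]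
      rfl
    have h2 : frobInner (replicateCol Unit v) (S * replicateCol Unit v) =
        ‖U * replicateCol Unit v‖ ^ 2 + t * ‖replicateCol Unit v‖ ^ 2 := by
      rw [hS, Matrix.add_mul, frobInner_add_right, Matrix.smul_mul, Matrix.one_mul,
        frobInner_smul_right, norm_sq_eq_frobInner, norm_sq_eq_frobInner, frobInner_mul_left,
        Matrix.mul_assoc]
    rw [h1, frobInner_zero_right] at h2
    have h3 := hU (replicateCol Unit v)
    have h4 : ‖replicateCol Unit v‖ ^ 2 = 0 :=
      le_antisymm (nonpos_of_mul_nonpos_right (by linarith) ha) (by positivity)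
    have h5 : replicateCol Unit v = 0 := norm_eq_zero.1 (pow_eq_zero_iff two_ne_zero |>.1 h4)
    exact hv (funext fun i => congrFun (congrFun h5 i) ())
  have hB : S * (S⁻¹ * (Uᵀ * X)) = Uᵀ * X := by
    rw [← Matrix.mul_assoc, mul_nonsing_inv _ hdet, Matrix.one_mul]
  generalize S⁻¹ * (Uᵀ * X) = B at hB
  have hUX : Uᵀ * (X - U * B) = t • B := by
    rw [Matrix.mul_sub, ← hB, hS, Matrix.add_mul, Matrix.smul_mul, Matrix.one_mul,
      Matrix.mul_assoc]
    abel
  refine ⟨B, X - U * B, by abel, hUX, ?_⟩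
  conv_lhs => rw [show X = U * B + (X - U * B) by abel]
  rw [norm_sq_add_frob, frobInner_mul_left, hUX, frobInner_smul_right, ← norm_sq_eq_frobInner]
  ring

theorem mul_norm_sq_le_of_forall_col {U : Matrix m n ℝ} {a : ℝ}
    (hU : ∀ y : Matrix n Unit ℝ, a * ‖y‖ ^ 2 ≤ ‖U * y‖ ^ 2) (Y : Matrix n k ℝ) :
    a * ‖Y‖ ^ 2 ≤ ‖U * Y‖ ^ 2 := by
  rw [norm_sq_eq_sum_col, norm_sq_eq_sum_col, Finset.mul_sum]
  refine Finset.sum_le_sum fun j _ => ?_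
  rw [← mul_replicateCol_col]
  exact hU _

/-- On the range of V, Vᵀ expands at least as much as V does: combine ‖VY‖² = ⟨Y, VᵀVY⟩ ≤ ‖Y‖‖VᵀVY‖
with the lower bound on V. -/
theorem sq_mul_norm_sq_le_gram {V : Matrix m n ℝ} {a : ℝ} (ha : 0 < a)
    (hV : ∀ y : Matrix n Unit ℝ, a * ‖y‖ ^ 2 ≤ ‖V * y‖ ^ 2) (Y : Matrix n k ℝ) :
    a * ‖V * Y‖ ^ 2 ≤ ‖Vᵀ * (V * Y)‖ ^ 2 := by
  have h1 := mul_norm_sq_le_of_forall_col hV Y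
  have h2 : ‖V * Y‖ ^ 2 ≤ ‖Y‖ * ‖Vᵀ * (V * Y)‖ := by
    rw [norm_sq_eq_frobInner, frobInner_mul_left]
    exact (le_abs_self _).trans (abs_frobInner_le _ _)
  rcases (norm_nonneg Y).eq_or_lt with h0 | h0
  · rw [← h0] at h2
    nlinarith [sq_nonneg ‖V * Y‖, sq_nonneg ‖Vᵀ * (V * Y)‖]
  · have h3 : a * ‖Y‖ ≤ ‖Vᵀ * (V * Y)‖ :=
      le_of_mul_le_mul_left (by nlinarith) h0
    calc a * ‖V * Y‖ ^ 2 ≤ a * (‖Y‖ * ‖Vᵀ * (V * Y)‖) := by gcongr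
      _ = (a * ‖Y‖) * ‖Vᵀ * (V * Y)‖ := by ring
      _ ≤ _ := by rw [sq]; gcongr

end Projection

/-! ### A lower bound for low-rank approximation. -/

section EckartYoung

variable {m n : Type*} [Fintype m] [Fintype n] [DecidableEq n]

/-- Dimension count: the range of C has dimension r + k and the kernel of N has codimension at most
r. -/
theorem exists_orthonormal_in_range_inf_ker {j : Type*} [Fintype j] [DecidableEq j]
    {C : Matrix n j ℝ} (hC : Function.Injective C.mulVec) {r k : ℕ} {N : Matrix m n ℝ}
    (hN : N.rank ≤ r) (hj : Fintype.card j = r + k) :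
    ∃ (K : ℕ) (E : Matrix n (Fin K) ℝ) (Y : Matrix j (Fin K) ℝ), k ≤ K ∧ Eᵀ * E = 1 ∧
      E = C * Y ∧ N * E = 0 := by
  let TC := toEuclideanLin C
  let TN := toEuclideanLin N
  let S := LinearMap.range TC ⊓ LinearMap.ker TN
  have hTC : Module.finrank ℝ (LinearMap.range TC) = r + k := by
    rw [LinearMap.finrank_range_of_inj, finrank_euclideanSpace, hj]
    intro x y hxy
    apply (WithLp.ofLp_injective 2)
    apply hC
    simpa [TC, toLpLin_apply] using hxy
  have hTN : Module.finrank ℝ (LinearMap.range TN) ≤ r := by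
    rwa [rank_eq_finrank_range_toLin N (EuclideanSpace.basisFun m ℝ).toBasis
      (EuclideanSpace.basisFun n ℝ).toBasis, ← toEuclideanLin_eq_toLin_orthonormal] at hN
  have h1 := Submodule.finrank_sup_add_finrank_inf_eq (LinearMap.range TC) (LinearMap.ker TN)
  have h2 := LinearMap.finrank_range_add_finrank_ker TN
  have h3 := Submodule.finrank_le (LinearMap.range TC ⊔ LinearMap.ker TN)
  have hS : Module.finrank ℝ S = Module.finrank ℝ ↥(LinearMap.range TC ⊓ LinearMap.ker TN) := rfl
  let b := stdOrthonormalBasis ℝ S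
  have hb : ∀ i, ∃ y, TC y = (b i : EuclideanSpace ℝ n) := fun i => (b i).2.1
  choose y hy using hb
  refine ⟨Module.finrank ℝ S, of fun a i => (b i : EuclideanSpace ℝ n) a, of fun a i => y i a,
    ?_, ?_, ?_, ?_⟩
  · omega
  · ext i i'
    have := orthonormal_iff_ite.1 b.orthonormal i i'
    simp only [Submodule.coe_inner, PiLp.inner_apply, RCLike.inner_apply, conj_trivial] at this
    simp only [mul_apply, transpose_apply, of_apply, one_apply]
    rw [← this]
    exact Finset.sum_congr rfl fun a _ => mul_comm _ _
  · ext a i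
    rw [of_apply, ← hy i]
    simp [TC, toLpLin_apply, mul_apply, mulVec, dotProduct]
  · ext a i
    have : TN (b i) = 0 := (b i).2.2
    have := congrArg (fun v => v a) this
    simpa [TN, toLpLin_apply, mul_apply, mulVec, dotProduct] using this

/-- The matrix A = UVᵀ + aPQᵀ stretches every vector of the (r+k)-dimensional range of [V Q] by at
least a. The kernel of N meets that range in dimension at least k, and on an orthonormal family E
there (A - N)E = AE. -/
theorem eckart_young_lower_bound {r k : ℕ} {U : Matrix m (Fin r) ℝ} {V : Matrix n (Fin r) ℝ}
    {a : ℝ} (ha : 0 < a)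
    (hU : ∀ y : Matrix (Fin r) Unit ℝ, a * ‖y‖ ^ 2 ≤ ‖U * y‖ ^ 2)
    (hV : ∀ y : Matrix (Fin r) Unit ℝ, a * ‖y‖ ^ 2 ≤ ‖V * y‖ ^ 2)
    {P : Matrix m (Fin k) ℝ} {Q : Matrix n (Fin k) ℝ} (hP : Pᵀ * P = 1) (hQ : Qᵀ * Q = 1)
    (hUP : Uᵀ * P = 0) (hVQ : Vᵀ * Q = 0) {N : Matrix m n ℝ} (hN : N.rank ≤ r) :
    a ^ 2 * k ≤ ‖U * Vᵀ + a • (P * Qᵀ) - N‖ ^ 2 := by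
  have hQV : Qᵀ * V = 0 := by
    rw [← transpose_transpose (Qᵀ * V), transpose_mul, transpose_transpose, hVQ, transpose_zero]
  have hsplit : ∀ {l : Type} [Fintype l] (y : Matrix (Fin r) l ℝ) (z : Matrix (Fin k) l ℝ),
      ‖V * y + Q * z‖ ^ 2 = ‖V * y‖ ^ 2 + ‖z‖ ^ 2 := by
    intro l _ y z
    rw [norm_sq_add_frob, norm_sq_mul_of_orthonormal hQ, frobInner_mul_left, ← Matrix.mul_assoc,
      hVQ, Matrix.zero_mul, frobInner_zero_right, mul_zero, add_zero]
  have hC : Function.Injective (fromCols V Q).mulVec := by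
    rw [← coe_mulVecLin, injective_iff_map_eq_zero]
    intro v hv
    have h0 : V * replicateCol Unit (v ∘ Sum.inl) + Q * replicateCol Unit (v ∘ Sum.inr) = 0 := by
      rw [mulVecLin_apply, fromCols_mulVec] at hv
      rw [← replicateCol_mulVec, ← replicateCol_mulVec, ← replicateCol_add, hv]
      rfl
    have h1 := hsplit (replicateCol Unit (v ∘ Sum.inl)) (replicateCol Unit (v ∘ Sum.inr))
    rw [h0, norm_zero] at h1
    have h2 := hV (replicateCol Unit (v ∘ Sum.inl))
    have h3 : ‖replicateCol Unit (v ∘ Sum.inl)‖ = 0 := by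
      by_contra h
      have : 0 < ‖replicateCol Unit (v ∘ Sum.inl)‖ := lt_of_le_of_ne (norm_nonneg _) (Ne.symm h)
      have : 0 < a * ‖replicateCol Unit (v ∘ Sum.inl)‖ ^ 2 := by positivity
      nlinarith [sq_nonneg ‖replicateCol Unit (v ∘ Sum.inr)‖]
    have h4 : ‖replicateCol Unit (v ∘ Sum.inr)‖ = 0 := by
      by_contra h
      have : 0 < ‖replicateCol Unit (v ∘ Sum.inr)‖ := lt_of_le_of_ne (norm_nonneg _) (Ne.symm h)
      nlinarith [sq_nonneg ‖V * replicateCol Unit (v ∘ Sum.inl)‖]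
    rw [norm_eq_zero] at h3 h4
    ext (i | i)
    · exact congrFun (congrFun h3 i) ()
    · exact congrFun (congrFun h4 i) ()
  obtain ⟨K, E, Y, hK, hE, hEY, hNE⟩ := exists_orthonormal_in_range_inf_ker (k := k) hC hN (by simp)
  rw [← fromRows_toRows Y, fromCols_mul_fromRows] at hEY
  generalize Y.toRows₁ = Y₁ at hEY
  generalize Y.toRows₂ = Y₂ at hEY
  have hEnorm := norm_sq_of_orthonormal hE
  rw [Fintype.card_fin, hEY, hsplit] at hEnorm
  have hME : (U * Vᵀ + a • (P * Qᵀ) - N) * E = U * (Vᵀ * (V * Y₁)) + P * (a • Y₂) := by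
    rw [Matrix.sub_mul, hNE, sub_zero, hEY, Matrix.add_mul, Matrix.smul_mul, Matrix.mul_assoc,
      Matrix.mul_assoc, Matrix.mul_add, Matrix.mul_add, ← Matrix.mul_assoc Vᵀ Q, hVQ, Matrix.mul_add,
      ← Matrix.mul_assoc Qᵀ V, hQV, ← Matrix.mul_assoc Qᵀ Q, hQ]
    simp
  have h1 := norm_sq_mul_le_of_orthonormal hE (U * Vᵀ + a • (P * Qᵀ) - N)
  rw [hME, norm_sq_add_frob, norm_sq_mul_of_orthonormal hP, frobInner_mul_left,
    ← Matrix.mul_assoc Uᵀ, hUP, Matrix.zero_mul, frobInner_zero_right, norm_smul, mul_pow,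
    Real.norm_eq_abs, sq_abs] at h1
  have h2 := mul_norm_sq_le_of_forall_col hU (Vᵀ * (V * Y₁))
  have h3 := sq_mul_norm_sq_le_gram ha hV Y₁
  have hK' : (k : ℝ) ≤ K := by exact_mod_cast hK
  calc a ^ 2 * k ≤ a ^ 2 * K := by gcongr
    _ = a * (a * ‖V * Y₁‖ ^ 2) + a ^ 2 * ‖Y₂‖ ^ 2 := by rw [← hEnorm]; ring
    _ ≤ a * ‖Vᵀ * (V * Y₁)‖ ^ 2 + a ^ 2 * ‖Y₂‖ ^ 2 := by gcongr
    _ ≤ _ := by linarith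

end EckartYoung

/-! ### Procrustes distance between factorizations. -/

section Procrustes

variable {m n l : Type*} [Fintype m] [Fintype n] [Fintype l] [DecidableEq n]

omit [Fintype m] [DecidableEq n] in
-- With A, A' the two Gram matrices and B = WᵀW', the left side is ‖K‖² for K = A + A' - 2B.
-- Positivity of B gives ⟨K, B⟩ ≥ 0, hence ‖K‖² ≤ ‖A + A'‖² - 4‖B‖², and the parallelogram law
-- finishes.
theorem norm_sq_gram_le_of_posSemidef {W W' : Matrix m n ℝ} [Fintype m]
    (hB : (Wᵀ * W').PosSemidef) :
    ‖(W - W')ᵀ * (W - W')‖ ^ 2 ≤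
      2 * (‖Wᵀ * W‖ ^ 2 + ‖W'ᵀ * W'‖ ^ 2 - 2 * ‖Wᵀ * W'‖ ^ 2) := by
  have hsymm : W'ᵀ * W = Wᵀ * W' := by
    have := hB.1.eq
    rw [conjTranspose_eq_transpose_of_trivial, transpose_mul, transpose_transpose] at this
    exact this
  have hK : (W - W')ᵀ * (W - W') = Wᵀ * W + W'ᵀ * W' - (2 : ℝ) • (Wᵀ * W') := by
    rw [transpose_sub, Matrix.sub_mul, Matrix.mul_sub, Matrix.mul_sub, hsymm, two_smul]
    abel
  have h1 : 0 ≤ frobInner ((W - W')ᵀ * (W - W')) (Wᵀ * W') := by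
    have h := (hB.mul_mul_conjTranspose_same (W - W')).trace_nonneg
    rw [conjTranspose_eq_transpose_of_trivial, Matrix.mul_assoc, trace_mul_comm,
      Matrix.mul_assoc, trace_mul_comm] at h
    rwa [frobInner, transpose_mul, transpose_transpose]
  rw [hK] at h1 ⊢
  have h2 := sq_nonneg ‖Wᵀ * W - W'ᵀ * W'‖
  rw [norm_sq_sub_frob] at h2
  rw [norm_sq_sub_frob, norm_sq_add_frob, norm_smul, mul_pow, frobInner_smul_right]
  rw [frobInner_sub_left, frobInner_smul_left, ← norm_sq_eq_frobInner] at h1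
  norm_num
  linarith

theorem exists_orthogonal_norm_sub_mul_le (W W' : Matrix m n ℝ) :
    ∃ R : Matrix n n ℝ, Rᵀ * R = 1 ∧ R * Rᵀ = 1 ∧ (‖W - W' * R‖ ^ 2) ^ 2 ≤
      2 * Fintype.card n * (‖Wᵀ * W‖ ^ 2 + ‖W'ᵀ * W'‖ ^ 2 - 2 * ‖Wᵀ * W'‖ ^ 2) := by
  obtain ⟨R, hR, hR', hB⟩ := exists_orthogonal_mul_posSemidef (Wᵀ * W')
  refine ⟨R, hR, hR', ?_⟩
  have hright : ∀ {a : Type _} [Fintype a] (A : Matrix a n ℝ), ‖A * R‖ ^ 2 = ‖A‖ ^ 2 := by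
    intro a _ A
    rw [norm_sq_eq_frobInner, frobInner_mul_right, Matrix.mul_assoc, hR', Matrix.mul_one,
      norm_sq_eq_frobInner]
  rw [Matrix.mul_assoc] at hB
  have h := norm_sq_gram_le_of_posSemidef hB
  have h1 : ‖(W' * R)ᵀ * (W' * R)‖ ^ 2 = ‖W'ᵀ * W'‖ ^ 2 := by
    rw [← Matrix.mul_assoc, hright, transpose_mul, Matrix.mul_assoc,
      norm_sq_mul_of_orthonormal (by rwa [transpose_transpose])]
  rw [h1, ← Matrix.mul_assoc, hright] at h
  have h2 := trace_sq_le ((W - W' * R)ᵀ * (W - W' * R))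
  change (frobInner _ _) ^ 2 ≤ _ at h2
  rw [← norm_sq_eq_frobInner] at h2
  calc _ ≤ _ := h2
    _ ≤ Fintype.card n * (2 * (‖Wᵀ * W‖ ^ 2 + ‖W'ᵀ * W'‖ ^ 2 - 2 * ‖Wᵀ * W'‖ ^ 2)) := by gcongr
    _ = _ := by ring

omit [DecidableEq n] in
theorem norm_sq_fromRows (A : Matrix m n ℝ) (B : Matrix l n ℝ) :
    ‖fromRows A B‖ ^ 2 = ‖A‖ ^ 2 + ‖B‖ ^ 2 := by
  simp [norm_sq_eq_frobInner, frobInner_eq_sum, Finset.sum_add_distrib]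

omit [DecidableEq n] in
theorem frobInner_mul_transpose (A A' : Matrix m n ℝ) (B B' : Matrix l n ℝ) :
    frobInner (A * Bᵀ) (A' * B'ᵀ) = frobInner (Aᵀ * A') (Bᵀ * B') := by
  rw [frobInner_mul_left, ← Matrix.mul_assoc, frobInner_comm, frobInner_mul_right,
    transpose_transpose]

/-- Apply the previous bound to the stacked factors. Balance turns ‖W'ᵀW'‖² into 4‖U'V'ᵀ‖², and
‖UᵀU' + VᵀV'‖² ≥ 4⟨UᵀU', VᵀV'⟩ = 4⟨UVᵀ, U'V'ᵀ⟩ handles the cross term. -/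
theorem exists_orthogonal_factor_distance_le (U U' : Matrix m n ℝ) (V V' : Matrix l n ℝ)
    (hbal : U'ᵀ * U' = V'ᵀ * V') :
    ∃ R : Matrix n n ℝ, Rᵀ * R = 1 ∧ R * Rᵀ = 1 ∧
      (‖U - U' * R‖ ^ 2 + ‖V - V' * R‖ ^ 2) ^ 2 ≤ 2 * Fintype.card n *
        (4 * ‖U * Vᵀ - U' * V'ᵀ‖ ^ 2 + ‖Uᵀ * U - Vᵀ * V‖ ^ 2) := by
  obtain ⟨R, hR, hR', h⟩ := exists_orthogonal_norm_sub_mul_le (fromRows U V) (fromRows U' V')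
  refine ⟨R, hR, hR', ?_⟩
  have hsub : fromRows U V - fromRows U' V' * R = fromRows (U - U' * R) (V - V' * R) := by
    rw [fromRows_mul]
    ext (i | i) j <;> simp
  rw [hsub, norm_sq_fromRows] at h
  simp only [transpose_fromRows, fromCols_mul_fromRows, ← hbal] at h
  refine h.trans (mul_le_mul_of_nonneg_left ?_ (by positivity))
  have h3 := sq_nonneg ‖Uᵀ * U' - Vᵀ * V'‖
  rw [norm_sq_sub_frob] at h3 ⊢
  rw [norm_sq_sub_frob]
  simp only [norm_sq_add_frob]
  rw [norm_sq_eq_frobInner (U * Vᵀ), norm_sq_eq_frobInner (U' * V'ᵀ), frobInner_mul_transpose, frobInner_mul_transpose,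
    frobInner_mul_transpose,
    ← hbal, ← norm_sq_eq_frobInner (U'ᵀ * U')]
  linarith

end Procrustes

/-! ### Derivatives along lines and parabolas. -/

section SecondOrder

variable {E : Type*} [NormedAddCommGroup E] [NormedSpace ℝ E]

theorem hasDerivAt_line (x v : E) (t : ℝ) : HasDerivAt (fun s : ℝ => x + s • v) v t :=
  (((hasDerivAt_id t).smul_const v).const_add x).congr_deriv (one_smul _ _)

theorem hasDerivAt_comp_line {F : E → ℝ} (hF : ContDiff ℝ 2 F) (x v : E) (t : ℝ) :
    HasDerivAt (fun s : ℝ => F (x + s • v)) (fderiv ℝ F (x + t • v) v) t := by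
  have h1 := hasDerivAt_line x v t
  exact ((hF.differentiable (by norm_num)) (x + t • v)).hasFDerivAt.comp_hasDerivAt t h1

theorem hasDerivAt_fderiv_comp_line {F : E → ℝ} (hF : ContDiff ℝ 2 F) (x v : E) (t : ℝ) :
    HasDerivAt (fun s : ℝ => fderiv ℝ F (x + s • v) v) (curvature F (x + t • v) v) t := by
  have h1 := hasDerivAt_line x v t
  have h2 : Differentiable ℝ (fderiv ℝ F) :=
    (hF.fderiv_right (m := 1) (by norm_num)).differentiable (by norm_num)
  have h3 := (h2 (x + t • v)).hasFDerivAt.comp_hasDerivAt t h1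
  exact (h3.clm_apply (hasDerivAt_const t v)).congr_deriv (by simp [curvature])

/-- Lets the gradient and Hessian form of ρ be read off from one-variable calculus along a line. -/
theorem curvature_eq_of_hasDerivAt {F : E → ℝ} (hF : ContDiff ℝ 2 F) {x v : E} {k : ℝ → ℝ}
    {c : ℝ} (hk : ∀ t, HasDerivAt (fun s : ℝ => F (x + s • v)) (k t) t) (hc : HasDerivAt k c 0) :
    fderiv ℝ F x v = k 0 ∧ curvature F x v = c := by
  have h1 : (fun s : ℝ => fderiv ℝ F (x + s • v) v) = k :=
    funext fun t => (hasDerivAt_comp_line hF x v t).unique (hk t)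
  have h2 := hasDerivAt_fderiv_comp_line hF x v 0
  rw [h1] at h2
  refine ⟨by simp [← h1], ?_⟩
  simpa using h2.unique hc

theorem taylor_lower_bounds {h k k' : ℝ → ℝ} {a : ℝ} (hh : ∀ t, HasDerivAt h (k t) t)
    (hk : ∀ t, HasDerivAt k (k' t) t) (ha : ∀ t ∈ Set.Icc (0 : ℝ) 1, a ≤ k' t) :
    a ≤ k 1 - k 0 ∧ a / 2 ≤ h 1 - h 0 - k 0 := by
  have h1 : MonotoneOn (fun t => k t - a * t) (Set.Icc 0 1) := by
    have hd : ∀ t, HasDerivAt (fun t => k t - a * t) (k' t - a) t := fun t =>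
      ((hk t).sub ((hasDerivAt_id t).const_mul a)).congr_deriv (by simp)
    refine monotoneOn_of_deriv_nonneg (convex_Icc 0 1)
      (fun t _ => (hd t).continuousAt.continuousWithinAt)
      (fun t _ => (hd t).differentiableAt.differentiableWithinAt) fun t ht => ?_
    rw [(hd t).deriv]
    linarith [ha t (interior_subset ht)]
  have h2 : MonotoneOn (fun t => h t - k 0 * t - a / 2 * t ^ 2) (Set.Icc 0 1) := by
    have hd : ∀ t, HasDerivAt (fun t => h t - k 0 * t - a / 2 * t ^ 2) (k t - k 0 - a * t) t :=
      fun t => (((hh t).sub ((hasDerivAt_id t).const_mul (k 0))).sub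
          ((hasDerivAt_pow 2 t).const_mul (a / 2))).congr_deriv (by norm_num; ring)
    refine monotoneOn_of_deriv_nonneg (convex_Icc 0 1)
      (fun t _ => (hd t).continuousAt.continuousWithinAt)
      (fun t _ => (hd t).differentiableAt.differentiableWithinAt) fun t ht => ?_
    rw [(hd t).deriv]
    have := h1 (Set.left_mem_Icc.2 zero_le_one) (interior_subset ht) (interior_subset ht).1
    simp only [mul_zero, sub_zero] at this
    linarith
  have h3 := h1 (Set.left_mem_Icc.2 zero_le_one) (Set.right_mem_Icc.2 zero_le_one) zero_le_one
  have h4 := h2 (Set.left_mem_Icc.2 zero_le_one) (Set.right_mem_Icc.2 zero_le_one) zero_le_one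
  norm_num at h3 h4
  constructor <;> linarith

theorem hasDerivAt_quartic (a b c d e t : ℝ) : HasDerivAt
    (fun s : ℝ => a + s * b + s ^ 2 * c + s ^ 3 * d + s ^ 4 * e)
    (b + 2 * t * c + 3 * t ^ 2 * d + 4 * t ^ 3 * e) t :=
  ((((((hasDerivAt_id t).mul_const b).const_add a).add ((hasDerivAt_pow 2 t).mul_const c)).add
    ((hasDerivAt_pow 3 t).mul_const d)).add ((hasDerivAt_pow 4 t).mul_const e)).congr_deriv
    (by norm_num)

/-- A line in (U, V) maps to a parabola in UVᵀ; its quadratic term is what adds 2φ(w) to the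
curvature. -/
theorem hasDerivAt_parabola (x v w : E) (t : ℝ) :
    HasDerivAt (fun s : ℝ => x + s • v + s ^ 2 • w) (v + (2 * t) • w) t :=
  ((hasDerivAt_line x v t).add ((hasDerivAt_pow 2 t).smul_const w)).congr_deriv (by norm_num)

theorem hasDerivAt_comp_parabola {F : E → ℝ} (hF : ContDiff ℝ 2 F) (x v w : E) (t : ℝ) :
    HasDerivAt (fun s : ℝ => F (x + s • v + s ^ 2 • w))
      (fderiv ℝ F (x + t • v + t ^ 2 • w) (v + (2 * t) • w)) t :=
  ((hF.differentiable (by norm_num)) _).hasFDerivAt.comp_hasDerivAt t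
    (hasDerivAt_parabola x v w t)

theorem hasDerivAt_fderiv_comp_parabola {F : E → ℝ} (hF : ContDiff ℝ 2 F) (x v w : E) :
    HasDerivAt (fun t : ℝ => fderiv ℝ F (x + t • v + t ^ 2 • w) (v + (2 * t) • w))
      (curvature F x v + 2 * fderiv ℝ F x w) 0 := by
  have h2 : Differentiable ℝ (fderiv ℝ F) :=
    (hF.fderiv_right (m := 1) (by norm_num)).differentiable (by norm_num)
  have h3 := (h2 _).hasFDerivAt.comp_hasDerivAt 0 (hasDerivAt_parabola x v w 0)
  have h4 : HasDerivAt (fun t : ℝ => v + (2 * t) • w) ((2 : ℝ) • w) 0 :=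
    ((((hasDerivAt_id (0 : ℝ)).const_mul 2).smul_const w).const_add v).congr_deriv (by simp)
  exact (h3.clm_apply h4).congr_deriv (by simp [curvature])

end SecondOrder

/-! ### Smallest Hessian eigenvalue and Rayleigh quotients. -/

section Hessian

variable {E : Type*} [NormedAddCommGroup E] [InnerProductSpace ℝ E] [CompleteSpace E]

theorem inner_hessian {F : E → ℝ} (hF : ContDiff ℝ 2 F) (x v w : E) :
    inner ℝ (hessian F x v) w = fderiv ℝ (fderiv ℝ F) x v w := by
  let L : (E →L[ℝ] ℝ) →L[ℝ] E := LinearMap.mkContinuous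
    { toFun := (InnerProductSpace.toDual ℝ E).symm
      map_add' := map_add _
      map_smul' := fun a φ => by simp } 1 (fun φ => by simp)
  have hL : gradient F = fun y => L (fderiv ℝ F y) := rfl
  have h2 : Differentiable ℝ (fderiv ℝ F) :=
    (hF.fderiv_right (m := 1) (by norm_num)).differentiable (by norm_num)
  have h3 : hessian F x = L.comp (fderiv ℝ (fderiv ℝ F) x) := by
    rw [hessian, hL]
    exact (L.hasFDerivAt.comp x (h2 x).hasFDerivAt).fderiv
  rw [h3]
  exact InnerProductSpace.toDual_symm_apply

/-- The Hessian is symmetric, so in finite dimension the infimum of its Rayleigh quotient is an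
eigenvalue; the eigenvalue set is finite, so its `sInf` is a genuine lower bound. -/
theorem minEigenvalue_hessian_mul_le [FiniteDimensional ℝ E] {F : E → ℝ} (hF : ContDiff ℝ 2 F)
    (x v : E) : minEigenvalue (hessian F x) * ‖v‖ ^ 2 ≤ curvature F x v := by
  rcases eq_or_ne v 0 with rfl | hv
  · simp [curvature]
  have : Nontrivial E := ⟨v, 0, hv⟩
  set T : E →ₗ[ℝ] E := (hessian F x : E →ₗ[ℝ] E) with hT
  have hsymm : T.IsSymmetric := fun a b => by
    change inner ℝ (hessian F x a) b = inner ℝ a (hessian F x b)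
    rw [real_inner_comm _ a, inner_hessian hF, inner_hessian hF]
    exact (hF.contDiffAt.isSymmSndFDerivAt (by simp)) a b
  have hfin : {c : ℝ | Module.End.HasEigenvalue T c}.Finite := Module.End.finite_hasEigenvalue T
  have h1 : minEigenvalue (hessian F x) ≤ _ :=
    csInf_le hfin.bddBelow hsymm.hasEigenvalue_iInf_of_finiteDimensional
  have hbdd : BddBelow (Set.range fun y : {y : E // y ≠ 0} =>
      RCLike.re (inner ℝ (T y) (y : E)) / ‖(y : E)‖ ^ 2) := by
    refine ⟨-‖hessian F x‖, ?_⟩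
    rintro _ ⟨y, rfl⟩
    have hy : 0 < ‖(y : E)‖ ^ 2 := by
      have := norm_pos_iff.2 y.2
      positivity
    simp only [RCLike.re_to_real]
    rw [le_div_iff₀ hy]
    have h2 := abs_real_inner_le_norm (T y) (y : E)
    have h3 : ‖T y‖ ≤ ‖hessian F x‖ * ‖(y : E)‖ := (hessian F x).le_opNorm y
    have h4 : ‖T y‖ * ‖(y : E)‖ ≤ ‖hessian F x‖ * ‖(y : E)‖ * ‖(y : E)‖ := by gcongr
    linarith [neg_le_of_abs_le h2]
  have h2 := h1.trans (ciInf_le hbdd ⟨v, hv⟩)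
  have hv2 : 0 < ‖v‖ ^ 2 := by
    have := norm_pos_iff.2 hv
    positivity
  rw [le_div_iff₀ hv2] at h2
  refine h2.trans_eq ?_
  exact inner_hessian hF x v v

end Hessian

/-! ### First and second derivatives of the factored objective. -/

section Factored

variable {n m r : ℕ}

/-- The pair `(U, V)` as an element of the factor space. -/
def factorPair (U : Matrix (Fin n) (Fin r) ℝ) (V : Matrix (Fin m) (Fin r) ℝ) :
    FactorSpace n m r :=
  WithLp.toLp 2 fun p => Sum.elim (fun i => U i p.2) (fun j => V j p.2) p.1

@[simp] theorem upper_factorPair (U : Matrix (Fin n) (Fin r) ℝ) (V : Matrix (Fin m) (Fin r) ℝ) :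
    upper (factorPair U V) = U := rfl

@[simp] theorem lower_factorPair (U : Matrix (Fin n) (Fin r) ℝ) (V : Matrix (Fin m) (Fin r) ℝ) :
    lower (factorPair U V) = V := rfl

theorem upper_add (W H : FactorSpace n m r) : upper (W + H) = upper W + upper H := rfl

theorem lower_add (W H : FactorSpace n m r) : lower (W + H) = lower W + lower H := rfl

theorem upper_smul (t : ℝ) (W : FactorSpace n m r) : upper (t • W) = t • upper W := rfl

theorem lower_smul (t : ℝ) (W : FactorSpace n m r) : lower (t • W) = t • lower W := rfl

theorem upper_sub (W H : FactorSpace n m r) : upper (W - H) = upper W - upper H := rfl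

theorem lower_sub (W H : FactorSpace n m r) : lower (W - H) = lower W - lower H := rfl

theorem factorSpace_norm_sq (W : FactorSpace n m r) :
    ‖W‖ ^ 2 = ‖upper W‖ ^ 2 + ‖lower W‖ ^ 2 := by
  rw [EuclideanSpace.norm_sq_eq, norm_sq_eq_frobInner, norm_sq_eq_frobInner, frobInner_eq_sum,
    frobInner_eq_sum, Fintype.sum_prod_type, Fintype.sum_sum_type, Finset.sum_comm]
  congr 1
  · simp [upper, pow_two]
  · rw [Finset.sum_comm]
    simp [lower, pow_two]

/-- The imbalance `Uᵀ U - Vᵀ V` of a pair of factors. -/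
def imbalance (W : FactorSpace n m r) : Matrix (Fin r) (Fin r) ℝ :=
  (upper W)ᵀ * upper W - (lower W)ᵀ * lower W

theorem contDiff_rho {f : Matrix (Fin n) (Fin m) ℝ → ℝ} (hf : ContDiff ℝ 2 f) (μ : ℝ) :
    ContDiff ℝ 2 (rho r f μ) := by
  let β₁ : FactorSpace n m r →ₗ[ℝ] FactorSpace n m r →ₗ[ℝ] Matrix (Fin n) (Fin m) ℝ :=
    LinearMap.mk₂ ℝ (fun W H => upper W * (lower H)ᵀ)
      (fun _ _ _ => by rw [upper_add, Matrix.add_mul])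
      (fun _ _ _ => by rw [upper_smul, Matrix.smul_mul])
      (fun _ _ _ => by rw [lower_add, transpose_add, Matrix.mul_add])
      (fun _ _ _ => by rw [lower_smul, transpose_smul, Matrix.mul_smul])
  let β₂ : FactorSpace n m r →ₗ[ℝ] FactorSpace n m r →ₗ[ℝ] Matrix (Fin r) (Fin r) ℝ :=
    LinearMap.mk₂ ℝ (fun W H => (upper W)ᵀ * upper H - (lower W)ᵀ * lower H)
      (fun _ _ _ => by simp only [upper_add, lower_add, transpose_add, Matrix.add_mul]; abel)
      (fun _ _ _ => by
        simp only [upper_smul, lower_smul, transpose_smul, Matrix.smul_mul, smul_sub])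
      (fun _ _ _ => by simp only [upper_add, lower_add, Matrix.mul_add]; abel)
      (fun _ _ _ => by simp only [upper_smul, lower_smul, Matrix.mul_smul, smul_sub])
  let β₃ : Matrix (Fin r) (Fin r) ℝ →ₗ[ℝ] Matrix (Fin r) (Fin r) ℝ →ₗ[ℝ] ℝ :=
    LinearMap.mk₂ ℝ frobInner frobInner_add_left frobInner_smul_left frobInner_add_right
      frobInner_smul_right
  have h1 : ContDiff ℝ 2 fun W : FactorSpace n m r => β₁.toContinuousBilinearMap W W :=
    β₁.toContinuousBilinearMap.contDiff.clm_apply contDiff_id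
  have h2 : ContDiff ℝ 2 fun W : FactorSpace n m r => β₂.toContinuousBilinearMap W W :=
    β₂.toContinuousBilinearMap.contDiff.clm_apply contDiff_id
  have h3 : ContDiff ℝ 2 fun A : Matrix (Fin r) (Fin r) ℝ => β₃.toContinuousBilinearMap A A :=
    β₃.toContinuousBilinearMap.contDiff.clm_apply contDiff_id
  have h4 : rho r f μ = fun W : FactorSpace n m r => f (β₁.toContinuousBilinearMap W W) +
      μ / 4 * β₃.toContinuousBilinearMap (β₂.toContinuousBilinearMap W W)
        (β₂.toContinuousBilinearMap W W) := by
    funext W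
    rw [rho, norm_sq_eq_frobInner]
    rfl
  rw [h4]
  exact (hf.comp h1).add (contDiff_const.mul (h3.comp h2))

theorem rho_line (f : Matrix (Fin n) (Fin m) ℝ → ℝ) (μ : ℝ) (W H : FactorSpace n m r)
    {M₁ M₂ M : Matrix (Fin n) (Fin m) ℝ} {δ : Matrix (Fin r) (Fin r) ℝ}
    (hM₁ : M₁ = upper W * (lower H)ᵀ + upper H * (lower W)ᵀ)
    (hM₂ : M₂ = upper H * (lower H)ᵀ) (hM : M = upper W * (lower W)ᵀ)
    (hδ : δ = (upper W)ᵀ * upper H + (upper H)ᵀ * upper W -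
        (lower W)ᵀ * lower H - (lower H)ᵀ * lower W) (s : ℝ) :
    rho r f μ (W + s • H) = f (M + s • M₁ + s ^ 2 • M₂) +
      μ / 4 * (‖imbalance W‖ ^ 2 + s * (2 * frobInner (imbalance W) δ) +
        s ^ 2 * (‖δ‖ ^ 2 + 2 * frobInner (imbalance W) (imbalance H)) +
        s ^ 3 * (2 * frobInner δ (imbalance H)) + s ^ 4 * ‖imbalance H‖ ^ 2) := by
  have e1 : upper (W + s • H) * (lower (W + s • H))ᵀ = M + s • M₁ + s ^ 2 • M₂ := by
    simp only [upper_add, upper_smul, lower_add, lower_smul, transpose_add, transpose_smul,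
      Matrix.add_mul, Matrix.mul_add, Matrix.smul_mul, Matrix.mul_smul, hM, hM₁, hM₂, smul_add,
      smul_smul, pow_two]
    abel
  have e2 : (upper (W + s • H))ᵀ * upper (W + s • H) - (lower (W + s • H))ᵀ * lower (W + s • H)
      = imbalance W + s • δ + s ^ 2 • imbalance H := by
    simp only [upper_add, upper_smul, lower_add, lower_smul, transpose_add, transpose_smul,
      Matrix.add_mul, Matrix.mul_add, Matrix.smul_mul, Matrix.mul_smul, hδ, imbalance,
      smul_add, smul_sub, smul_smul, pow_two]
    abel
  rw [rho, e1, e2, norm_sq_add_frob, norm_sq_add_frob]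
  simp only [frobInner_add_left, frobInner_smul_left, frobInner_smul_right, norm_smul, mul_pow,
    Real.norm_eq_abs, sq_abs]
  ring

theorem rho_derivatives {f : Matrix (Fin n) (Fin m) ℝ → ℝ} (hf : ContDiff ℝ 2 f) (μ : ℝ)
    (W H : FactorSpace n m r) :
    fderiv ℝ (rho r f μ) W H =
      fderiv ℝ f (upper W * (lower W)ᵀ) (upper W * (lower H)ᵀ + upper H * (lower W)ᵀ) +
      μ * (frobInner (upper W * imbalance W) (upper H) -
        frobInner (lower W * imbalance W) (lower H)) ∧
    curvature (rho r f μ) W H =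
      curvature f (upper W * (lower W)ᵀ) (upper W * (lower H)ᵀ + upper H * (lower W)ᵀ) +
      2 * fderiv ℝ f (upper W * (lower W)ᵀ) (upper H * (lower H)ᵀ) +
      μ / 2 * ‖(upper W)ᵀ * upper H + (upper H)ᵀ * upper W -
        (lower W)ᵀ * lower H - (lower H)ᵀ * lower W‖ ^ 2 +
      μ * frobInner (imbalance W) (imbalance H) := by
  have hfd : frobInner (imbalance W) ((upper W)ᵀ * upper H + (upper H)ᵀ * upper W -
      (lower W)ᵀ * lower H - (lower H)ᵀ * lower W) =
      2 * (frobInner (upper W * imbalance W) (upper H) -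
        frobInner (lower W * imbalance W) (lower H)) := by
    have hΔt : (imbalance W)ᵀ = imbalance W := by
      simp [imbalance, transpose_sub, transpose_mul]
    have hs : ∀ {a : ℕ} (A B : Matrix (Fin a) (Fin r) ℝ),
        frobInner (imbalance W) (Aᵀ * B) = frobInner (A * imbalance W) B ∧
        frobInner (imbalance W) (Bᵀ * A) = frobInner (A * imbalance W) B := by
      intro a A B
      rw [frobInner_mul_left]
      refine ⟨rfl, ?_⟩
      rw [← frobInner_transpose, hΔt, transpose_mul, transpose_transpose]
    rw [frobInner_sub_right, frobInner_sub_right, frobInner_add_right, (hs _ _).1,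
      (hs _ _).2, (hs _ _).1, (hs _ _).2]
    ring
  have hline := rho_line f μ W H rfl rfl rfl rfl
  generalize upper W * (lower H)ᵀ + upper H * (lower W)ᵀ = M₁ at *
  generalize upper H * (lower H)ᵀ = M₂ at *
  generalize upper W * (lower W)ᵀ = M at *
  generalize (upper W)ᵀ * upper H + (upper H)ᵀ * upper W -
        (lower W)ᵀ * lower H - (lower H)ᵀ * lower W = δ at *
  have hk : ∀ t, HasDerivAt (fun s : ℝ => rho r f μ (W + s • H))
      (fderiv ℝ f (M + t • M₁ + t ^ 2 • M₂) (M₁ + (2 * t) • M₂) +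
      μ / 4 * (2 * frobInner (imbalance W) δ +
        2 * t * (‖δ‖ ^ 2 + 2 * frobInner (imbalance W) (imbalance H)) +
        3 * t ^ 2 * (2 * frobInner δ (imbalance H)) + 4 * t ^ 3 * ‖imbalance H‖ ^ 2)) t :=
    fun t => ((hasDerivAt_comp_parabola hf M M₁ M₂ t).add
      ((hasDerivAt_quartic (‖imbalance W‖ ^ 2) (2 * frobInner (imbalance W) δ)
        (‖δ‖ ^ 2 + 2 * frobInner (imbalance W) (imbalance H)) (2 * frobInner δ (imbalance H))
        (‖imbalance H‖ ^ 2) t).const_mul (μ / 4))).congr_of_eventuallyEq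
        (Filter.Eventually.of_forall hline)
  have hc : HasDerivAt (fun t : ℝ => fderiv ℝ f (M + t • M₁ + t ^ 2 • M₂) (M₁ + (2 * t) • M₂) +
      μ / 4 * (2 * frobInner (imbalance W) δ +
        2 * t * (‖δ‖ ^ 2 + 2 * frobInner (imbalance W) (imbalance H)) +
        3 * t ^ 2 * (2 * frobInner δ (imbalance H)) + 4 * t ^ 3 * ‖imbalance H‖ ^ 2))
      (curvature f M M₁ + 2 * fderiv ℝ f M M₂ +
        μ / 4 * (2 * (‖δ‖ ^ 2 + 2 * frobInner (imbalance W) (imbalance H)))) 0 := by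
    have h := (hasDerivAt_quartic (2 * frobInner (imbalance W) δ)
      (2 * (‖δ‖ ^ 2 + 2 * frobInner (imbalance W) (imbalance H)))
      (3 * (2 * frobInner δ (imbalance H))) (4 * ‖imbalance H‖ ^ 2) 0 0).const_mul (μ / 4)
    refine (hasDerivAt_fderiv_comp_parabola hf M M₁ M₂).add
      ((h.congr_of_eventuallyEq (Filter.Eventually.of_forall fun t => ?_)).congr_deriv ?_)
    · ring
    · ring
  obtain ⟨hfst, hsnd⟩ := curvature_eq_of_hasDerivAt (contDiff_rho hf μ) hk hc
  constructor
  · rw [hfst, hfd]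
    simp only [zero_smul, add_zero, mul_zero, zero_mul, ne_eq, OfNat.ofNat_ne_zero,
      not_false_eq_true, zero_pow]
    ring
  · rw [hsnd]
    ring

end Factored

/-! ### Consequences of restricted isometry. -/

section RestrictedIsometry

variable {n m r : ℕ}

theorem rank_mul_transpose_le_width (U : Matrix (Fin n) (Fin r) ℝ) (V : Matrix (Fin m) (Fin r) ℝ) :
    (U * Vᵀ).rank ≤ r :=
  (rank_mul_le_left _ _).trans ((rank_le_card_width U).trans_eq (Fintype.card_fin r))

variable {f : Matrix (Fin n) (Fin m) ℝ → ℝ} {δ : ℝ}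

theorem RIP.line_bounds (hR : RIP f r r δ) (hf : ContDiff ℝ 2 f) {X K : Matrix (Fin n) (Fin m) ℝ}
    (hXK : ∀ t : ℝ, (X + t • K).rank ≤ 2 * r) (hK : K.rank ≤ 2 * r) :
    (1 - δ) * ‖K‖ ^ 2 ≤ fderiv ℝ f (X + K) K - fderiv ℝ f X K ∧
    (1 - δ) * ‖K‖ ^ 2 / 2 ≤ f (X + K) - f X - fderiv ℝ f X K ∧
    f (X + K) - f X - fderiv ℝ f X K ≤ (1 + δ) * ‖K‖ ^ 2 / 2 := by
  have h1 := fun t => hasDerivAt_comp_line hf X K t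
  have h2 := fun t => hasDerivAt_fderiv_comp_line hf X K t
  have lo := taylor_lower_bounds h1 h2 (a := (1 - δ) * ‖K‖ ^ 2)
    fun t _ => (hR.2.2 _ K (hXK t) hK).1
  have hi := taylor_lower_bounds (h := fun t : ℝ => -f (X + t • K))
    (k := fun t : ℝ => -fderiv ℝ f (X + t • K) K) (k' := fun t : ℝ => -curvature f (X + t • K) K)
    (fun t => (h1 t).neg) (fun t => (h2 t).neg)
    (a := -((1 + δ) * ‖K‖ ^ 2)) fun t _ => neg_le_neg (hR.2.2 _ K (hXK t) hK).2
  simp only [one_smul, zero_smul, add_zero] at lo hi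
  exact ⟨lo.1, lo.2, by linarith [hi.2]⟩

theorem rank_add_le_add (X Y : Matrix (Fin n) (Fin m) ℝ) : (X + Y).rank ≤ X.rank + Y.rank := by
  have h : LinearMap.range (X + Y).mulVecLin ≤
      LinearMap.range X.mulVecLin ⊔ LinearMap.range Y.mulVecLin := by
    rintro _ ⟨v, rfl⟩
    rw [mulVecLin_add]
    exact Submodule.add_mem_sup ⟨v, rfl⟩ ⟨v, rfl⟩
  exact (Submodule.finrank_mono h).trans (Submodule.finrank_add_le_finrank_add_finrank _ _)

theorem rank_smul_le (c : ℝ) (X : Matrix (Fin n) (Fin m) ℝ) : (c • X).rank ≤ X.rank := by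
  have h : c • X = X * (c • (1 : Matrix (Fin m) (Fin m) ℝ)) := by
    rw [Matrix.mul_smul, Matrix.mul_one]
  rw [h]
  exact rank_mul_le_left _ _

theorem rank_add_smul_sub_le {X Y : Matrix (Fin n) (Fin m) ℝ} (hX : X.rank ≤ r) (hY : Y.rank ≤ r)
    (t : ℝ) : (X + t • (Y - X)).rank ≤ 2 * r ∧ (Y - X).rank ≤ 2 * r := by
  have h : ∀ a b : ℝ, (a • X + b • Y).rank ≤ 2 * r := fun a b => by
    have h1 := rank_add_le_add (a • X) (b • Y)
    have h3 := rank_smul_le a X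
    have h4 := rank_smul_le b Y
    omega
  constructor
  · convert h (1 - t) t using 2
    rw [smul_sub, sub_smul, one_smul]
    abel
  · convert h (-1) 1 using 2
    rw [neg_smul, one_smul, one_smul]
    abel

/-- Segments between matrices of rank at most r, and their directions, have rank at most 2r, so f is
strongly convex along them. -/
theorem RIP.le_of_critical (hR : RIP f r r δ) (hf : ContDiff ℝ 2 f)
    {N M : Matrix (Fin n) (Fin m) ℝ} (hN : IsCriticalPoint f N) (hNr : N.rank ≤ r)
    (hM : M.rank ≤ r) :
    f N ≤ f M ∧ (1 - δ) * ‖M - N‖ ^ 2 ≤ fderiv ℝ f M (M - N) := by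
  have h := hR.line_bounds hf (fun t => (rank_add_smul_sub_le hNr hM t).1)
    (rank_add_smul_sub_le hNr hM 0).2
  rw [add_sub_cancel, show fderiv ℝ f N = 0 from hN] at h
  simp only [_root_.zero_apply, sub_zero] at h
  have := mul_nonneg (sub_nonneg.2 hR.2.1.le) (sq_nonneg ‖M - N‖)
  exact ⟨by linarith [h.2.1], h.1⟩

/-- Coercivity of M ↦ φ(M). Going from 0 to M gives φ(M) ≥ f'(0)M + (1-δ)‖M‖² and f'(0)M ≥ f(M) -
f(0) - (1+δ)‖M‖²/2; then f(M) ≥ f(N) ≥ f(0) - (1+δ)‖N‖²/2. The coefficient is (1-δ) - (1+δ)/2 =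
(1-3δ)/2. -/
theorem RIP.fderiv_self_lower_bound (hR : RIP f r r δ) (hf : ContDiff ℝ 2 f)
    {N M : Matrix (Fin n) (Fin m) ℝ} (hN : IsCriticalPoint f N) (hNr : N.rank ≤ r)
    (hM : M.rank ≤ r) :
    (1 - 3 * δ) / 2 * ‖M‖ ^ 2 - (1 + δ) / 2 * ‖N‖ ^ 2 ≤ fderiv ℝ f M M := by
  have h0 : (0 : Matrix (Fin n) (Fin m) ℝ).rank ≤ r := by simp
  have h1 := hR.line_bounds hf (fun t => (rank_add_smul_sub_le h0 hM t).1)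
    (rank_add_smul_sub_le h0 hM 0).2
  have h2 := hR.line_bounds hf (fun t => (rank_add_smul_sub_le hNr h0 t).1)
    (rank_add_smul_sub_le hNr h0 0).2
  have h3 := (hR.le_of_critical hf hN hNr hM).1
  rw [add_sub_cancel, show fderiv ℝ f N = 0 from hN] at h2
  simp only [_root_.zero_apply, sub_zero, zero_sub, norm_neg, zero_add] at h1 h2
  linarith [h1.1, h1.2.2, h2.2.2]

end RestrictedIsometry

/-! ### Consequences of a small gradient. -/

section FirstOrder

variable {n m r : ℕ} {f : Matrix (Fin n) (Fin m) ℝ → ℝ} {μ g : ℝ} {W : FactorSpace n m r}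

theorem imbalance_transpose (W : FactorSpace n m r) : (imbalance W)ᵀ = imbalance W := by
  simp [imbalance, transpose_sub, transpose_mul]

theorem norm_sq_imbalance (W : FactorSpace n m r) :
    ‖imbalance W‖ ^ 2 = frobInner (upper W * imbalance W) (upper W) -
      frobInner (lower W * imbalance W) (lower W) := by
  rw [frobInner_mul_left, frobInner_mul_left (lower W), frobInner_comm,
    frobInner_comm (imbalance W), ← frobInner_sub_left, norm_sq_eq_frobInner, imbalance]

theorem first_order_tests (hf : ContDiff ℝ 2 f) (hg : ‖gradient (rho r f μ) W‖ ≤ g) :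
    (∀ X : Matrix (Fin n) (Fin r) ℝ, |fderiv ℝ f (upper W * (lower W)ᵀ) (X * (lower W)ᵀ) +
      μ * frobInner (upper W * imbalance W) X| ≤ g * ‖X‖) ∧
    (∀ Y : Matrix (Fin m) (Fin r) ℝ, |fderiv ℝ f (upper W * (lower W)ᵀ) (upper W * Yᵀ) -
      μ * frobInner (lower W * imbalance W) Y| ≤ g * ‖Y‖) := by
  have h : ∀ H : FactorSpace n m r, |fderiv ℝ (rho r f μ) W H| ≤ g * ‖H‖ := fun H => by
    rw [← inner_gradient_left]
    exact (abs_real_inner_le_norm _ _).trans (by gcongr)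
  constructor
  · intro X
    have hX : ‖(factorPair X 0 : FactorSpace n m r)‖ = ‖X‖ := by
      rw [← sq_eq_sq₀ (norm_nonneg _) (norm_nonneg _), factorSpace_norm_sq]
      simp
    have := h (factorPair X 0)
    rw [hX, (rho_derivatives hf μ W _).1] at this
    simpa [frobInner_zero_right] using this
  · intro Y
    have hY : ‖(factorPair 0 Y : FactorSpace n m r)‖ = ‖Y‖ := by
      rw [← sq_eq_sq₀ (norm_nonneg _) (norm_nonneg _), factorSpace_norm_sq]
      simp
    have := h (factorPair 0 Y)
    rw [hY, (rho_derivatives hf μ W _).1] at this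
    simpa [frobInner_zero_right, sub_eq_add_neg] using this

/-- Testing with X = UΔ and Y = VΔ feeds the same matrix UΔVᵀ to φ, so subtracting the two tests
eliminates f and leaves μ(a² + b²) ≤ g(a + b). -/
theorem norm_mul_imbalance_le (hf : ContDiff ℝ 2 f) (hμ : 0 < μ)
    (hg : ‖gradient (rho r f μ) W‖ ≤ g) :
    μ * (‖upper W * imbalance W‖ + ‖lower W * imbalance W‖) ≤ 2 * g := by
  obtain ⟨h1, h2⟩ := first_order_tests hf hg
  have e1 := le_of_abs_le (h1 (upper W * imbalance W))
  have e2 := neg_le_of_abs_le (h2 (lower W * imbalance W))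
  rw [transpose_mul, imbalance_transpose, ← Matrix.mul_assoc, ← norm_sq_eq_frobInner] at e2
  rw [← norm_sq_eq_frobInner] at e1
  set a := ‖upper W * imbalance W‖
  set b := ‖lower W * imbalance W‖
  have ha : 0 ≤ a := norm_nonneg _
  have hb : 0 ≤ b := norm_nonneg _
  have h3 : μ * (a ^ 2 + b ^ 2) ≤ g * (a + b) := by linarith
  rcases (add_nonneg ha hb).eq_or_lt with h0 | h0
  · rw [← h0, mul_zero]
    linarith [(norm_nonneg _).trans hg]
  · refine le_of_mul_le_mul_right (a := a + b) ?_ h0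
    nlinarith [mul_nonneg hμ.le (sq_nonneg (a - b))]

theorem abs_fderiv_mul_le (hf : ContDiff ℝ 2 f) (hμ : 0 < μ)
    (hg : ‖gradient (rho r f μ) W‖ ≤ g) :
    (∀ X : Matrix (Fin n) (Fin r) ℝ,
      |fderiv ℝ f (upper W * (lower W)ᵀ) (X * (lower W)ᵀ)| ≤ 3 * g * ‖X‖) ∧
    (∀ Y : Matrix (Fin m) (Fin r) ℝ,
      |fderiv ℝ f (upper W * (lower W)ᵀ) (upper W * Yᵀ)| ≤ 3 * g * ‖Y‖) := by
  obtain ⟨h1, h2⟩ := first_order_tests hf hg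
  have h3 := norm_mul_imbalance_le hf hμ hg
  have h4 : ∀ {a : ℕ} (A X : Matrix (Fin a) (Fin r) ℝ), μ * ‖A‖ ≤ 2 * g →
      |μ * frobInner A X| ≤ 2 * g * ‖X‖ := by
    intro a A X hA
    rw [abs_mul, abs_of_pos hμ]
    calc μ * |frobInner A X| ≤ μ * (‖A‖ * ‖X‖) := by gcongr; exact abs_frobInner_le _ _
      _ = (μ * ‖A‖) * ‖X‖ := by ring
      _ ≤ _ := by gcongr
  constructor
  · intro X
    have e1 := abs_le.1 (h1 X)
    have e2 := abs_le.1 (h4 (upper W * imbalance W) X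
      (by nlinarith [norm_nonneg (lower W * imbalance W)]))
    exact abs_le.2 ⟨by linarith [e1.1, e2.2], by linarith [e1.2, e2.1]⟩
  · intro Y
    have e1 := abs_le.1 (h2 Y)
    have e2 := abs_le.1 (h4 (lower W * imbalance W) Y
      (by nlinarith [norm_nonneg (upper W * imbalance W)]))
    exact abs_le.2 ⟨by linarith [e1.1, e2.1], by linarith [e1.2, e2.2]⟩

theorem norm_sq_imbalance_le (hf : ContDiff ℝ 2 f) (hμ : 0 < μ)
    (hg : ‖gradient (rho r f μ) W‖ ≤ g) {B : ℝ} (hU : ‖upper W‖ ≤ B) (hV : ‖lower W‖ ≤ B) :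
    μ * ‖imbalance W‖ ^ 2 ≤ 2 * g * B := by
  have h3 := norm_mul_imbalance_le hf hμ hg
  have h4 := norm_sq_imbalance W
  have h5 := le_of_abs_le (abs_frobInner_le (upper W * imbalance W) (upper W))
  have h6 := neg_le_of_abs_le (abs_frobInner_le (lower W * imbalance W) (lower W))
  have h7 : ‖imbalance W‖ ^ 2 ≤ (‖upper W * imbalance W‖ + ‖lower W * imbalance W‖) * B := by
    have h8 := mul_le_mul_of_nonneg_left hU (norm_nonneg (upper W * imbalance W))
    have h9 := mul_le_mul_of_nonneg_left hV (norm_nonneg (lower W * imbalance W))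
    linarith
  have hB : 0 ≤ B := (norm_nonneg _).trans hU
  calc μ * ‖imbalance W‖ ^ 2
      ≤ μ * ((‖upper W * imbalance W‖ + ‖lower W * imbalance W‖) * B) := by gcongr
    _ = (μ * (‖upper W * imbalance W‖ + ‖lower W * imbalance W‖)) * B := by ring
    _ ≤ _ := by gcongr

/-- An a priori bound for the factors at points where the gradient has norm at most one. -/
noncomputable def factorBound (δ : ℝ) (r : ℕ) (μ c : ℝ) : ℝ :=
  1 + r * (2 * c ^ 2 + 2) / min μ ((1 - 3 * δ) / 2)

theorem le_of_quartic_growth {u v b : ℝ} (hu : 0 ≤ u) (hv : 0 ≤ v) (c : ℝ)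
    (h : u ^ 4 + v ^ 4 ≤ b * (2 * c ^ 2 + u + v)) (hb : 0 ≤ b) :
    u ≤ 1 + b * (2 * c ^ 2 + 2) ∧ v ≤ 1 + b * (2 * c ^ 2 + 2) := by
  have hpos : 0 ≤ b * (2 * c ^ 2 + 2) := by positivity
  have key : ∀ x y : ℝ, 0 ≤ y → y ≤ x → x ^ 4 + y ^ 4 ≤ b * (2 * c ^ 2 + x + y) →
      x ≤ 1 + b * (2 * c ^ 2 + 2) := by
    intro x y hy hyx hxy
    rcases le_total x 1 with hx | hx
    · linarith
    have h0 : 0 < x := by linarith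
    have h1 : x ^ 4 ≤ b * (2 * c ^ 2 + 2) * x := by
      have h2 : 2 * c ^ 2 + x + y ≤ (2 * c ^ 2 + 2) * x := by nlinarith [sq_nonneg c]
      have h3 := mul_le_mul_of_nonneg_left h2 hb
      have : 0 ≤ y ^ 4 := by positivity
      linarith
    have h2 : x ^ 3 ≤ b * (2 * c ^ 2 + 2) := le_of_mul_le_mul_right (by linarith) h0
    have h3 : x ≤ x ^ 3 := le_self_pow₀ hx (by norm_num)
    linarith
  rcases le_total v u with huv | huv
  · have := key u v hv huv h
    exact ⟨this, huv.trans this⟩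
  · have := key v u hu huv (by linarith)
    exact ⟨huv.trans this, this⟩

/-- Testing the gradient with U and with V gives 2φ(M) + μ‖Δ‖² ≤ ‖U‖ + ‖V‖. Coercivity of φ(M) then
bounds ‖UᵀU‖² + ‖VᵀV‖² = ‖Δ‖² + 2‖M‖², which is quartic in the factors, by a linear expression. -/
theorem norm_factors_le {δ : ℝ} (hR : RIP f r r δ) (hδ : δ < 1 / 3) (hf : ContDiff ℝ 2 f)
    {N : Matrix (Fin n) (Fin m) ℝ} (hN : IsCriticalPoint f N) (hNr : N.rank ≤ r) (hμ : 0 < μ)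
    (hg : ‖gradient (rho r f μ) W‖ ≤ 1) :
    ‖upper W‖ ≤ factorBound δ r μ ‖N‖ ∧ ‖lower W‖ ≤ factorBound δ r μ ‖N‖ := by
  obtain ⟨h1, h2⟩ := first_order_tests hf hg
  have hM := hR.fderiv_self_lower_bound hf hN hNr
    (rank_mul_transpose_le_width (upper W) (lower W))
  have e1 := le_of_abs_le (h1 (upper W))
  have e2 := le_of_abs_le (h2 (lower W))
  have hΔ := norm_sq_imbalance W
  have hG : ‖(upper W)ᵀ * upper W‖ ^ 2 + ‖(lower W)ᵀ * lower W‖ ^ 2 =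
      ‖imbalance W‖ ^ 2 + 2 * ‖upper W * (lower W)ᵀ‖ ^ 2 := by
    rw [imbalance, norm_sq_sub_frob, norm_sq_eq_frobInner (upper W * (lower W)ᵀ),
      frobInner_mul_transpose]
    ring
  have hu := trace_sq_le ((upper W)ᵀ * upper W)
  have hv := trace_sq_le ((lower W)ᵀ * lower W)
  change (frobInner _ _) ^ 2 ≤ _ at hu hv
  rw [← norm_sq_eq_frobInner, Fintype.card_fin] at hu hv
  set u := ‖upper W‖
  set v := ‖lower W‖
  set κ := min μ ((1 - 3 * δ) / 2) with hκ
  have hκ0 : 0 < κ := lt_min hμ (by linarith)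
  have h3 : κ * (‖imbalance W‖ ^ 2 + 2 * ‖upper W * (lower W)ᵀ‖ ^ 2) ≤
      2 * ‖N‖ ^ 2 + u + v := by
    have h4 := mul_le_mul_of_nonneg_right (min_le_left μ ((1 - 3 * δ) / 2))
      (sq_nonneg ‖imbalance W‖)
    have h5 := mul_le_mul_of_nonneg_right (min_le_right μ ((1 - 3 * δ) / 2))
      (sq_nonneg ‖upper W * (lower W)ᵀ‖)
    have h6 : (1 + δ) * ‖N‖ ^ 2 ≤ 2 * ‖N‖ ^ 2 := by
      gcongr
      linarith
    have h7 : μ * ‖imbalance W‖ ^ 2 = μ * frobInner (upper W * imbalance W) (upper W) -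
      μ * frobInner (lower W * imbalance W) (lower W) := by rw [hΔ]; ring
    linarith
  have h4 : u ^ 4 + v ^ 4 ≤ r / κ * (2 * ‖N‖ ^ 2 + u + v) := by
    rw [div_mul_eq_mul_div, le_div_iff₀ hκ0]
    calc (u ^ 4 + v ^ 4) * κ ≤
        (r * (‖imbalance W‖ ^ 2 + 2 * ‖upper W * (lower W)ᵀ‖ ^ 2)) * κ := by
          gcongr
          rw [← hG]
          linarith
      _ = r * (κ * (‖imbalance W‖ ^ 2 + 2 * ‖upper W * (lower W)ᵀ‖ ^ 2)) := by ring
      _ ≤ _ := by gcongr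
  have h5 := le_of_quartic_growth (norm_nonneg _) (norm_nonneg _) ‖N‖ h4 (by positivity)
  rwa [div_mul_eq_mul_div] at h5

end FirstOrder

/-! ### Rank-one matrices and the smallest stacked singular value. -/

section Columns

variable {m n k : Type*} [Fintype m] [Fintype n] [Fintype k]

theorem frobInner_col_mul_transpose (x x' : Matrix m Unit ℝ) (y y' : Matrix n Unit ℝ) :
    frobInner (x * yᵀ) (x' * y'ᵀ) = frobInner x x' * frobInner y y' := by
  rw [frobInner_mul_transpose]
  simp [frobInner, trace, mul_apply, mul_comm]

theorem norm_sq_col_mul_transpose (x : Matrix m Unit ℝ) (y : Matrix n Unit ℝ) :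
    ‖x * yᵀ‖ ^ 2 = ‖x‖ ^ 2 * ‖y‖ ^ 2 := by
  rw [norm_sq_eq_frobInner, frobInner_col_mul_transpose, ← norm_sq_eq_frobInner,
    ← norm_sq_eq_frobInner]

theorem norm_col_mul_transpose (x : Matrix m Unit ℝ) (y : Matrix n Unit ℝ) :
    ‖x * yᵀ‖ = ‖x‖ * ‖y‖ := by
  rw [← sq_eq_sq₀ (norm_nonneg _) (by positivity), norm_sq_col_mul_transpose, mul_pow]

omit [Fintype m] [Fintype n] in
theorem mul_diagonal_mul_transpose_eq_sum [DecidableEq k] (P : Matrix m k ℝ) (Q : Matrix n k ℝ)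
    (τ : k → ℝ) : P * diagonal τ * Qᵀ =
      ∑ i, τ i • (replicateCol Unit (P.col i) * (replicateCol Unit (Q.col i))ᵀ) := by
  ext a b
  rw [mul_apply, Matrix.sum_apply]
  refine Finset.sum_congr rfl fun i _ => ?_
  rw [mul_diagonal]
  simp [mul_apply]
  ring

omit [Fintype k] in
theorem norm_col_of_orthonormal [DecidableEq k] {P : Matrix m k ℝ} (hP : Pᵀ * P = 1) (i : k) :
    ‖replicateCol Unit (P.col i)‖ = 1 := by
  rw [← sq_eq_sq₀ (norm_nonneg _) zero_le_one, norm_sq_eq_frobInner, frobInner_eq_sum]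
  have := congrFun (congrFun hP i) i
  simpa [mul_apply] using this

theorem norm_add_sq_le_two (A B : Matrix m n ℝ) : ‖A + B‖ ^ 2 ≤ 2 * (‖A‖ ^ 2 + ‖B‖ ^ 2) := by
  have := sq_nonneg ‖A - B‖
  rw [norm_sq_sub_frob] at this
  rw [norm_sq_add_frob]
  linarith

theorem exists_unit_minimizer {l : Type*} [Fintype l] [Nonempty k] (U : Matrix m k ℝ)
    (V : Matrix l k ℝ) : ∃ z : Matrix k Unit ℝ, ‖z‖ = 1 ∧ ∀ y : Matrix k Unit ℝ,
      (‖U * z‖ ^ 2 + ‖V * z‖ ^ 2) * ‖y‖ ^ 2 ≤ ‖U * y‖ ^ 2 + ‖V * y‖ ^ 2 := by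
  have : ProperSpace (Matrix k Unit ℝ) := FiniteDimensional.proper_real _
  have : Nontrivial (Matrix k Unit ℝ) := inferInstance
  have hc : Continuous fun y : Matrix k Unit ℝ => ‖U * y‖ ^ 2 + ‖V * y‖ ^ 2 := by
    have h1 : Continuous fun y : Matrix k Unit ℝ => U * y := by fun_prop
    have h2 : Continuous fun y : Matrix k Unit ℝ => V * y := by fun_prop
    exact (h1.norm.pow 2).add (h2.norm.pow 2)
  obtain ⟨z, hz, hmin⟩ := (isCompact_sphere (0 : Matrix k Unit ℝ) 1).exists_isMinOn
    (NormedSpace.sphere_nonempty.2 zero_le_one) hc.continuousOn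
  refine ⟨z, by simpa using hz, fun y => ?_⟩
  rcases eq_or_ne y 0 with rfl | hy
  · simp
  have hy' : 0 < ‖y‖ := norm_pos_iff.2 hy
  have h := hmin (show ‖y‖⁻¹ • y ∈ Metric.sphere (0 : Matrix k Unit ℝ) 1 by
    simp [norm_smul, hy'.ne'])
  simp only [Set.mem_ofPred_eq, Matrix.mul_smul, norm_smul, norm_inv, norm_norm, mul_pow] at h
  rw [← mul_add, inv_pow, inv_mul_eq_div, le_div_iff₀ (by positivity)] at h
  exact h

end Columns

/-! ### The second-order test along rank-one perturbations. -/

section SecondOrderTest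

variable {n m r : ℕ} {f : Matrix (Fin n) (Fin m) ℝ → ℝ} {δ μ γ : ℝ} {W : FactorSpace n m r}

/-- Since zᵀz = 1, the perturbation (xzᵀ, yzᵀ) has second-order product term exactly xyᵀ, so the
Hessian bound controls φ(xyᵀ). The other terms are estimated by RIP and Cauchy–Schwarz. -/
theorem second_order_test (hR : RIP f r r δ) (hf : ContDiff ℝ 2 f) (hμ : 0 < μ)
    (hγ : -γ ≤ minEigenvalue (hessian (rho r f μ) W)) {z : Matrix (Fin r) Unit ℝ} (hz : ‖z‖ = 1)
    (x : Matrix (Fin n) Unit ℝ) (y : Matrix (Fin m) Unit ℝ) :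
    -(2 * fderiv ℝ f (upper W * (lower W)ᵀ) (x * yᵀ)) ≤ γ * (‖x‖ ^ 2 + ‖y‖ ^ 2) +
      (1 + δ) * ‖upper W * z * yᵀ + x * (lower W * z)ᵀ‖ ^ 2 +
      4 * μ * (‖(upper W)ᵀ * x‖ ^ 2 + ‖(lower W)ᵀ * y‖ ^ 2) +
      μ * |‖x‖ ^ 2 - ‖y‖ ^ 2| * ‖imbalance W‖ := by
  have hzz : zᵀ * z = 1 := by
    ext
    have h := norm_sq_eq_frobInner z
    rw [hz, frobInner] at h
    simpa [trace] using h.symm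
  have h1 := minEigenvalue_hessian_mul_le (contDiff_rho hf μ) W
    (factorPair (x * zᵀ) (y * zᵀ))
  rw [(rho_derivatives hf μ W _).2, factorSpace_norm_sq] at h1
  simp only [upper_factorPair, lower_factorPair, norm_sq_col_mul_transpose, hz, one_pow, mul_one,
    transpose_mul, transpose_transpose] at h1
  have h2 := mul_le_mul_of_nonneg_right hγ (by positivity : 0 ≤ ‖x‖ ^ 2 + ‖y‖ ^ 2)
  have e1 : upper W * (z * yᵀ) + x * zᵀ * (lower W)ᵀ =
      upper W * z * yᵀ + x * (lower W * z)ᵀ := by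
    rw [transpose_mul, Matrix.mul_assoc, Matrix.mul_assoc]
  have e2 : x * zᵀ * (z * yᵀ) = x * yᵀ := by
    rw [Matrix.mul_assoc, ← Matrix.mul_assoc zᵀ, hzz, Matrix.one_mul]
  have hrank : ∀ (x' : Matrix (Fin n) (Fin r) ℝ) (y' : Matrix (Fin m) (Fin r) ℝ),
      (upper W * y'ᵀ + x' * (lower W)ᵀ).rank ≤ 2 * r := fun x' y' => by
    have h3 := rank_add_le_add (upper W * y'ᵀ) (x' * (lower W)ᵀ)
    have h4 := rank_mul_transpose_le_width (upper W) y'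
    have h5 := rank_mul_transpose_le_width x' (lower W)
    omega
  have h3 := (hR.2.2 (upper W * (lower W)ᵀ) (upper W * (z * yᵀ) + x * zᵀ * (lower W)ᵀ)
    ((rank_mul_transpose_le_width _ _).trans (by omega))
    (by simpa using hrank (x * zᵀ) (y * zᵀ))).2
  set A := (upper W)ᵀ * x - (lower W)ᵀ * y with hA
  have e3 : (upper W)ᵀ * (x * zᵀ) + z * xᵀ * upper W - (lower W)ᵀ * (y * zᵀ) -
      z * yᵀ * lower W = A * zᵀ + z * Aᵀ := by
    rw [hA, transpose_sub, transpose_mul, transpose_mul, transpose_transpose, transpose_transpose,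
      Matrix.sub_mul, Matrix.mul_sub]
    simp only [Matrix.mul_assoc]
    abel
  have h4 : ‖A * zᵀ + z * Aᵀ‖ ^ 2 ≤ 8 * (‖(upper W)ᵀ * x‖ ^ 2 + ‖(lower W)ᵀ * y‖ ^ 2) := by
    have h5 := norm_add_sq_le_two (A * zᵀ) (z * Aᵀ)
    have h6 := norm_add_sq_le_two ((upper W)ᵀ * x) (-((lower W)ᵀ * y))
    rw [norm_sq_col_mul_transpose, norm_sq_col_mul_transpose, hz] at h5
    rw [← sub_eq_add_neg, ← hA, norm_neg] at h6
    linarith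
  have e4 : imbalance (factorPair (x * zᵀ) (y * zᵀ)) = (‖x‖ ^ 2 - ‖y‖ ^ 2) • (z * zᵀ) := by
    have h5 : ∀ {a : ℕ} (w : Matrix (Fin a) Unit ℝ), (w * zᵀ)ᵀ * (w * zᵀ) =
        ‖w‖ ^ 2 • (z * zᵀ) := fun w => by
      have h6 : wᵀ * w = ‖w‖ ^ 2 • (1 : Matrix Unit Unit ℝ) := by
        ext
        rw [norm_sq_eq_frobInner, frobInner]
        simp [trace]
      rw [transpose_mul, transpose_transpose, Matrix.mul_assoc, ← Matrix.mul_assoc wᵀ, h6,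
        Matrix.smul_mul, Matrix.one_mul, Matrix.mul_smul]
    rw [imbalance, upper_factorPair, lower_factorPair, h5, h5, sub_smul]
  have h5 : frobInner (imbalance W) (imbalance (factorPair (x * zᵀ) (y * zᵀ))) ≤
      |‖x‖ ^ 2 - ‖y‖ ^ 2| * ‖imbalance W‖ := by
    rw [e4, frobInner_smul_right]
    refine (le_abs_self _).trans ?_
    rw [abs_mul]
    have := abs_frobInner_le (imbalance W) (z * zᵀ)
    rw [norm_col_mul_transpose, hz, one_mul, mul_one] at this
    gcongr
  rw [e3, e2] at h1
  rw [e1] at h1 h3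
  have h6 := mul_le_mul_of_nonneg_left h4 (half_pos hμ).le
  have h7 := mul_le_mul_of_nonneg_left h5 hμ.le
  linarith

end SecondOrderTest

/-! ### Bounding -φ(N): degenerate and well-conditioned factors. -/

section Cases

variable {n m r : ℕ} {φ : Matrix (Fin n) (Fin m) ℝ →L[ℝ] ℝ} {U : Matrix (Fin n) (Fin r) ℝ}
  {V : Matrix (Fin m) (Fin r) ℝ} {N : Matrix (Fin n) (Fin m) ℝ} {z : Matrix (Fin r) Unit ℝ}
  {g γ δ μ d θ s : ℝ}

theorem neg_apply_le_of_small_singular_value (hμ : 0 < μ) (hδ : 0 ≤ δ) (hg : 0 ≤ g) (hγ : 0 ≤ γ)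
    (hd : 0 ≤ d) (hθ : 0 < θ)
    (hφV : ∀ X : Matrix (Fin n) (Fin r) ℝ, |φ (X * Vᵀ)| ≤ 3 * g * ‖X‖)
    (hφU : ∀ Y : Matrix (Fin m) (Fin r) ℝ, |φ (U * Yᵀ)| ≤ 3 * g * ‖Y‖)
    (hso : ∀ (x : Matrix (Fin n) Unit ℝ) (y : Matrix (Fin m) Unit ℝ),
      -(2 * φ (x * yᵀ)) ≤ γ * (‖x‖ ^ 2 + ‖y‖ ^ 2) +
        (1 + δ) * ‖U * z * yᵀ + x * (V * z)ᵀ‖ ^ 2 +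
        4 * μ * (‖Uᵀ * x‖ ^ 2 + ‖Vᵀ * y‖ ^ 2) + μ * |‖x‖ ^ 2 - ‖y‖ ^ 2| * d)
    (hs : ‖U * z‖ ^ 2 + ‖V * z‖ ^ 2 ≤ θ ^ 2) (hN : N.rank ≤ r) :
    -φ N ≤ r * ‖N‖ *
      (6 * g / θ + γ + (1 + δ) * θ ^ 2 + 2 * μ * θ ^ 2 + μ * d / 2) := by
  -- Ridge parameter θ²: the norm identity gives 2θ²‖b‖² ≤ 1, which bounds both b and Aᵀp₂ = θ²b
  -- without any conditioning of A.
  have hproj : ∀ {a : ℕ} (A : Matrix (Fin a) (Fin r) ℝ) (p : Matrix (Fin a) Unit ℝ), ‖p‖ = 1 →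
      ∃ (b : Matrix (Fin r) Unit ℝ) (p₂ : Matrix (Fin a) Unit ℝ), p = A * b + p₂ ∧
        ‖b‖ ≤ 1 / θ ∧ ‖p₂‖ ^ 2 ≤ 1 ∧ ‖Aᵀ * p₂‖ ^ 2 ≤ θ ^ 2 / 2 := by
    intro a A p hp
    obtain ⟨b, p₂, h1, h2, h3⟩ := exists_regularized_projection A p (t := θ ^ 2) (a := θ ^ 2)
      (by positivity) (fun y => by linarith [sq_nonneg ‖A * y‖])
    rw [hp, one_pow] at h3
    have h4 : 0 ≤ θ ^ 2 * ‖b‖ ^ 2 := by positivity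
    refine ⟨b, p₂, h1, ?_, ?_, ?_⟩
    · rw [le_div_iff₀ hθ]
      refine le_of_sq_le_sq ?_ zero_le_one
      nlinarith [sq_nonneg ‖p₂‖, sq_nonneg ‖A * b‖]
    · nlinarith [sq_nonneg ‖A * b‖]
    · rw [h2, norm_smul, mul_pow, Real.norm_eq_abs, sq_abs]
      nlinarith [sq_nonneg ‖p₂‖, sq_nonneg ‖A * b‖, sq_nonneg θ]
  set C := 6 * g / θ + γ + (1 + δ) * θ ^ 2 + 2 * μ * θ ^ 2 + μ * d / 2 with hC
  have hC0 : 0 ≤ C := by positivity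
  have hunit : ∀ (p : Matrix (Fin n) Unit ℝ) (q : Matrix (Fin m) Unit ℝ), ‖p‖ = 1 → ‖q‖ = 1 →
      -φ (p * qᵀ) ≤ C := by
    intro p q hp hq
    obtain ⟨b, x, hpx, hb, hx, hUx⟩ := hproj U p hp
    obtain ⟨e, y, hqy, he, hy, hVy⟩ := hproj V q hq
    -- The first two terms are of the forms controlled by the gradient; only xyᵀ needs the
    -- second-order test.
    have hsplit : p * qᵀ = U * (q * bᵀ)ᵀ + (x * eᵀ) * Vᵀ + x * yᵀ := by
      conv_lhs => rw [hpx, Matrix.add_mul]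
      rw [transpose_mul, transpose_transpose, Matrix.mul_assoc, add_assoc]
      congr 1
      rw [hqy, transpose_add, transpose_mul, Matrix.mul_add, Matrix.mul_assoc]
    have h1 := neg_le_of_abs_le (hφU (q * bᵀ))
    have h2 := neg_le_of_abs_le (hφV (x * eᵀ))
    have hx1 : ‖x‖ ≤ 1 := by
      refine le_of_sq_le_sq (by simpa using hx) zero_le_one
    rw [norm_col_mul_transpose, hq, one_mul] at h1
    rw [norm_col_mul_transpose] at h2
    have h3 : 3 * g * ‖b‖ ≤ 3 * g * (1 / θ) := by gcongr
    have h4 : 3 * g * (‖x‖ * ‖e‖) ≤ 3 * g * (1 / θ) := by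
      gcongr
      calc ‖x‖ * ‖e‖ ≤ 1 * (1 / θ) := by gcongr
        _ = _ := one_mul _
    have h5 := hso x y
    have h6 : ‖U * z * yᵀ + x * (V * z)ᵀ‖ ^ 2 ≤ 2 * θ ^ 2 := by
      refine (norm_add_sq_le_two _ _).trans ?_
      rw [norm_sq_col_mul_transpose, norm_sq_col_mul_transpose]
      have := mul_le_mul_of_nonneg_left hy (sq_nonneg ‖U * z‖)
      have := mul_le_mul_of_nonneg_right hx (sq_nonneg ‖V * z‖)
      linarith
    have h7 : (1 + δ) * ‖U * z * yᵀ + x * (V * z)ᵀ‖ ^ 2 ≤ (1 + δ) * (2 * θ ^ 2) := by gcongr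
    have h8 : 4 * μ * (‖Uᵀ * x‖ ^ 2 + ‖Vᵀ * y‖ ^ 2) ≤ 4 * μ * (θ ^ 2 / 2 + θ ^ 2 / 2) := by
      gcongr
    have h9 : |‖x‖ ^ 2 - ‖y‖ ^ 2| ≤ 1 :=
      abs_le.2 ⟨by linarith [sq_nonneg ‖x‖], by linarith [sq_nonneg ‖y‖]⟩
    have h10 : μ * |‖x‖ ^ 2 - ‖y‖ ^ 2| * d ≤ μ * 1 * d := by gcongr
    have h11 : γ * (‖x‖ ^ 2 + ‖y‖ ^ 2) ≤ γ * (1 + 1) := by gcongr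
    rw [hsplit, map_add, map_add, hC]
    have h12 : 6 * g / θ = 3 * g * (1 / θ) + 3 * g * (1 / θ) := by ring
    rw [h12]
    linarith
  obtain ⟨k, P, Q, τ, hk, hτ, hP, hQ, hfac⟩ := exists_svd N
  have hτN : ∀ i, τ i ≤ ‖N‖ := by
    intro i
    have h1 : ‖N‖ ^ 2 = ‖diagonal τ‖ ^ 2 := by
      rw [hfac, Matrix.mul_assoc, norm_sq_mul_of_orthonormal hP, norm_sq_eq_frobInner,
        frobInner_mul_right, transpose_transpose, Matrix.mul_assoc, hQ, Matrix.mul_one,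
        ← norm_sq_eq_frobInner]
    have h2 : τ i ^ 2 ≤ ‖diagonal τ‖ ^ 2 := by
      rw [frobenius_norm_diagonal, EuclideanSpace.norm_sq_eq]
      simpa using Finset.single_le_sum (f := fun j => τ j ^ 2) (fun j _ => sq_nonneg _)
        (Finset.mem_univ i)
    rw [← h1] at h2
    exact le_of_sq_le_sq h2 (norm_nonneg _)
  have hkr : (k : ℝ) ≤ r := by exact_mod_cast hk.trans hN
  calc -φ N = ∑ i, τ i * -φ (replicateCol Unit (P.col i) * (replicateCol Unit (Q.col i))ᵀ) := by
        rw [hfac, mul_diagonal_mul_transpose_eq_sum, map_sum, ← Finset.sum_neg_distrib]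
        simp
    _ ≤ ∑ _i : Fin k, ‖N‖ * C := by
        refine Finset.sum_le_sum fun i _ => ?_
        calc _ ≤ τ i * C := mul_le_mul_of_nonneg_left (hunit _ _ (norm_col_of_orthonormal hP i)
              (norm_col_of_orthonormal hQ i)) (hτ i).le
          _ ≤ _ := mul_le_mul_of_nonneg_right (hτN i) hC0
    _ = k * (‖N‖ * C) := by simp
    _ ≤ r * (‖N‖ * C) := by gcongr
    _ = _ := by ring

theorem neg_apply_le_of_large_singular_value (hg : 0 ≤ g) (hθ : 0 < θ) {a : ℝ}
    (ha : θ ^ 2 / 4 ≤ a)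
    (hU : ∀ y : Matrix (Fin r) Unit ℝ, a * ‖y‖ ^ 2 ≤ ‖U * y‖ ^ 2)
    (hV : ∀ y : Matrix (Fin r) Unit ℝ, a * ‖y‖ ^ 2 ≤ ‖V * y‖ ^ 2)
    (hφV : ∀ X : Matrix (Fin n) (Fin r) ℝ, |φ (X * Vᵀ)| ≤ 3 * g * ‖X‖)
    (hφU : ∀ Y : Matrix (Fin m) (Fin r) ℝ, |φ (U * Yᵀ)| ≤ 3 * g * ‖Y‖)
    (hso : ∀ (x : Matrix (Fin n) Unit ℝ) (y : Matrix (Fin m) Unit ℝ),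
      -(2 * φ (x * yᵀ)) ≤ γ * (‖x‖ ^ 2 + ‖y‖ ^ 2) +
        (1 + δ) * ‖U * z * yᵀ + x * (V * z)ᵀ‖ ^ 2 +
        4 * μ * (‖Uᵀ * x‖ ^ 2 + ‖Vᵀ * y‖ ^ 2) + μ * |‖x‖ ^ 2 - ‖y‖ ^ 2| * d)
    (hs : ‖U * z‖ ^ 2 + ‖V * z‖ ^ 2 = s) (hN : N.rank ≤ r) :
    ∃ T : ℝ, 0 ≤ T ∧ 2 * a * T ≤ ‖U * Vᵀ - N‖ ^ 2 ∧
      -φ N ≤ 12 * g * ‖N‖ / θ + T * ((1 + δ) * s / 2 + γ) := by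
  have ha0 : 0 < a := lt_of_lt_of_le (by positivity) ha
  have hdecomp : ∀ {p q : ℕ} (A : Matrix (Fin p) (Fin r) ℝ) (X : Matrix (Fin p) (Fin q) ℝ),
      (∀ y : Matrix (Fin r) Unit ℝ, a * ‖y‖ ^ 2 ≤ ‖A * y‖ ^ 2) → ‖X‖ ≤ ‖N‖ →
      ∃ (B : Matrix (Fin r) (Fin q) ℝ) (X₂ : Matrix (Fin p) (Fin q) ℝ), X = A * B + X₂ ∧
        Aᵀ * X₂ = 0 ∧ ‖X₂‖ ≤ ‖N‖ ∧ ‖B‖ ≤ 2 * ‖N‖ / θ := by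
    intro p q A X hA hX
    obtain ⟨B, X₂, h1, h2, h3⟩ := exists_regularized_projection A X (t := 0) ha0
      (fun y => by simpa using hA y)
    have h4 := mul_norm_sq_le_of_forall_col hA B
    have h5 := mul_le_mul_of_nonneg_right ha (sq_nonneg ‖B‖)
    have h6 : ‖X‖ ^ 2 ≤ ‖N‖ ^ 2 := by gcongr
    refine ⟨B, X₂, h1, by rw [h2, zero_smul], ?_, ?_⟩
    · exact le_of_sq_le_sq (by nlinarith [sq_nonneg ‖A * B‖]) (norm_nonneg _)
    · rw [le_div_iff₀ hθ]
      refine le_of_sq_le_sq ?_ (by positivity)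
      nlinarith [sq_nonneg ‖X₂‖]
  -- Two orthogonal projections give N = UY + XᵀVᵀ + Z with UᵀZ = 0 and ZV = 0; φ is small on the
  -- first two terms.
  obtain ⟨Y, M₂, hN1, hUM₂, hM₂, hY⟩ := hdecomp U N hU le_rfl
  obtain ⟨X, Zt, hM2, hVZ, -, hX⟩ := hdecomp V M₂ᵀ hV (by rwa [frobenius_norm_transpose])
  obtain ⟨Z, rfl⟩ : ∃ Z, Zt = Zᵀ := ⟨Ztᵀ, (transpose_transpose _).symm⟩
  have hM2' : M₂ = Xᵀ * Vᵀ + Z := by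
    rw [← transpose_transpose M₂, hM2, transpose_add, transpose_mul, transpose_transpose]
  have hXU : X * U = 0 := by
    have h1 : Vᵀ * (V * (X * U)) = 0 := by
      have h2 : M₂ᵀ * U = 0 := by
        rw [← transpose_transpose (M₂ᵀ * U), transpose_mul, transpose_transpose, hUM₂,
          transpose_zero]
      rw [hM2, Matrix.add_mul, Matrix.mul_assoc] at h2
      have h3 : Vᵀ * (V * (X * U) + Zᵀ * U) = 0 := by rw [h2, Matrix.mul_zero]
      rwa [Matrix.mul_add, ← Matrix.mul_assoc Vᵀ Zᵀ, hVZ, Matrix.zero_mul, add_zero] at h3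
    have h2 := sq_mul_norm_sq_le_gram ha0 hV (X * U)
    have h3 := mul_norm_sq_le_of_forall_col hV (X * U)
    rw [h1, norm_zero] at h2
    have h4 : ‖X * U‖ ^ 2 ≤ 0 := by
      by_contra h
      rw [not_le] at h
      have : 0 < a * ‖X * U‖ ^ 2 := by positivity
      nlinarith
    exact norm_eq_zero.1 (pow_eq_zero_iff two_ne_zero |>.1 (le_antisymm h4 (sq_nonneg _)))
  have hUX : Uᵀ * Xᵀ = 0 := by rw [← transpose_mul, hXU, transpose_zero]
  have hUZ : Uᵀ * Z = 0 := by
    rw [hM2', Matrix.mul_add, ← Matrix.mul_assoc, hUX, Matrix.zero_mul, zero_add] at hUM₂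
    exact hUM₂
  obtain ⟨k, P, Q, τ, -, hτ, hP, hQ, hfac⟩ := exists_svd Z
  have horth : ∀ {p q : ℕ} (A : Matrix (Fin p) (Fin r) ℝ) (P' : Matrix (Fin p) (Fin k) ℝ)
      (Q' : Matrix (Fin q) (Fin k) ℝ), Q'ᵀ * Q' = 1 → Aᵀ * (P' * diagonal τ * Q'ᵀ) = 0 →
      Aᵀ * P' = 0 := by
    intro p q A P' Q' hQ' h
    have h1 : Aᵀ * P' * diagonal τ = 0 := by
      have h2 : Aᵀ * (P' * diagonal τ * Q'ᵀ) * Q' = 0 := by rw [h, Matrix.zero_mul]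
      rwa [Matrix.mul_assoc, Matrix.mul_assoc, hQ', Matrix.mul_one, ← Matrix.mul_assoc] at h2
    ext i j
    have h2 := congrFun (congrFun h1 i) j
    rw [mul_diagonal] at h2
    exact (mul_eq_zero.1 h2).resolve_right (hτ j).ne'
  have hUP : Uᵀ * P = 0 := horth U P Q hQ (by rw [← hfac, hUZ])
  have hVQ : Vᵀ * Q = 0 := horth V Q P hP (by
    have : Q * diagonal τ * Pᵀ = Zᵀ := by
      rw [hfac, transpose_mul, transpose_mul, transpose_transpose, diagonal_transpose,
        Matrix.mul_assoc]
    rw [this, hVZ])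
  have hPU : Pᵀ * U = 0 := by
    rw [← transpose_transpose (Pᵀ * U), transpose_mul, transpose_transpose, hUP, transpose_zero]
  have hin1 : ∀ B : Matrix (Fin r) (Fin m) ℝ, frobInner (P * Qᵀ) (U * B) = 0 := fun B => by
    rw [frobInner_mul_left, ← Matrix.mul_assoc, hPU, Matrix.zero_mul, frobInner_zero_right]
  have hin2 : ∀ B : Matrix (Fin n) (Fin r) ℝ, frobInner (P * Qᵀ) (B * Vᵀ) = 0 := fun B => by
    rw [frobInner_mul_right, transpose_transpose, Matrix.mul_assoc, hVQ, Matrix.mul_zero,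
      frobInner_zero_right]
  have hin3 : frobInner (P * Qᵀ) Z = ∑ i, τ i := by
    rw [hfac, frobInner_mul_left, ← Matrix.mul_assoc, ← Matrix.mul_assoc, hP, Matrix.one_mul,
      frobInner_comm, frobInner_mul_right, transpose_transpose, hQ, frobInner_comm, frobInner,
      transpose_one, Matrix.one_mul, trace_diagonal]
  have hey := eckart_young_lower_bound ha0 hU hV hP hQ hUP hVQ hN
  have hPQ : ‖P * Qᵀ‖ ^ 2 = k := by
    rw [norm_sq_mul_of_orthonormal hP, frobenius_norm_transpose, norm_sq_of_orthonormal hQ,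
      Fintype.card_fin]
  have hrw : U * Vᵀ + a • (P * Qᵀ) - N = (U * Vᵀ - N) + a • (P * Qᵀ) := by abel
  -- Expanding the square, ⟨M - N, PQᵀ⟩ = -Στᵢ and the a²k terms cancel, leaving 2aΣτᵢ ≤ D.
  rw [hrw, norm_sq_add_frob, frobInner_smul_right, norm_smul, mul_pow, Real.norm_eq_abs, sq_abs,
    hPQ, frobInner_comm, frobInner_sub_right, hin1] at hey
  have hNin : frobInner (P * Qᵀ) N = ∑ i, τ i := by
    rw [hN1, hM2', frobInner_add_right, frobInner_add_right, hin1, hin2, hin3]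
    ring
  rw [hNin] at hey
  refine ⟨∑ i, τ i, Finset.sum_nonneg fun i _ => (hτ i).le, by linarith, ?_⟩
  have hφZ : -φ Z ≤ (∑ i, τ i) * ((1 + δ) * s / 2 + γ) := by
    conv_lhs => rw [hfac, mul_diagonal_mul_transpose_eq_sum, map_sum, ← Finset.sum_neg_distrib]
    rw [Finset.sum_mul]
    refine Finset.sum_le_sum fun i _ => ?_
    rw [map_smul, smul_eq_mul, ← mul_neg]
    refine mul_le_mul_of_nonneg_left ?_ (hτ i).le
    have hz0 : ∀ {p : ℕ} {A : Matrix (Fin p) (Fin r) ℝ} {P' : Matrix (Fin p) (Fin k) ℝ},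
        Aᵀ * P' = 0 → Aᵀ * replicateCol Unit (P'.col i) = 0 := fun {p A P'} h => by
      rw [mul_replicateCol_col, h]
      rfl
    -- At a pair of singular vectors of Z, Uᵀx and Vᵀy vanish, the norms agree, and the two pieces
    -- of the RIP term are orthogonal, so it is exactly (1+δ)s.
    have h1 := hso (replicateCol Unit (P.col i)) (replicateCol Unit (Q.col i))
    rw [hz0 hUP, hz0 hVQ, norm_sq_add_frob, norm_sq_col_mul_transpose, norm_sq_col_mul_transpose,
      frobInner_col_mul_transpose, frobInner_mul_left U, hz0 hUP, frobInner_zero_right,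
      norm_col_of_orthonormal hP, norm_col_of_orthonormal hQ, norm_zero] at h1
    norm_num at h1
    rw [hs] at h1
    rw [transpose_replicateCol]
    linarith
  have h1 := neg_le_of_abs_le (hφU Yᵀ)
  have h2 := neg_le_of_abs_le (hφV Xᵀ)
  rw [transpose_transpose, frobenius_norm_transpose] at h1
  rw [frobenius_norm_transpose] at h2
  have h3 := mul_le_mul_of_nonneg_left hY (by positivity : 0 ≤ 3 * g)
  have h4 := mul_le_mul_of_nonneg_left hX (by positivity : 0 ≤ 3 * g)
  rw [hN1, hM2', map_add, map_add, ← hM2', ← hN1]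
  have h5 : 12 * g * ‖N‖ / θ = 3 * g * (2 * ‖N‖ / θ) + 3 * g * (2 * ‖N‖ / θ) := by ring
  rw [h5]
  linarith

end Cases

/-! ### Uniform constants and distance to the minima. -/

section UniformBound

/-- Since ‖Uy‖² - ‖Vy‖² = ⟨y, Δy⟩, near balance splits a joint lower bound evenly between the
factors. -/
theorem mul_norm_sq_le_of_imbalance {n m r : ℕ} {W : FactorSpace n m r} {s d : ℝ}
    (hd : ‖imbalance W‖ ≤ d) (hs : ∀ y : Matrix (Fin r) Unit ℝ,
      s * ‖y‖ ^ 2 ≤ ‖upper W * y‖ ^ 2 + ‖lower W * y‖ ^ 2) :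
    (∀ y : Matrix (Fin r) Unit ℝ, (s - d) / 2 * ‖y‖ ^ 2 ≤ ‖upper W * y‖ ^ 2) ∧
    (∀ y : Matrix (Fin r) Unit ℝ, (s - d) / 2 * ‖y‖ ^ 2 ≤ ‖lower W * y‖ ^ 2) := by
  have h : ∀ y : Matrix (Fin r) Unit ℝ, |‖upper W * y‖ ^ 2 - ‖lower W * y‖ ^ 2| ≤ d * ‖y‖ ^ 2 := by
    intro y
    have h1 : ‖upper W * y‖ ^ 2 - ‖lower W * y‖ ^ 2 = frobInner y (imbalance W * y) := by
      rw [norm_sq_eq_frobInner, norm_sq_eq_frobInner, frobInner_mul_left, frobInner_mul_left,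
        ← frobInner_sub_right, imbalance, Matrix.sub_mul, Matrix.mul_assoc, Matrix.mul_assoc]
    rw [h1]
    calc _ ≤ ‖y‖ * ‖imbalance W * y‖ := abs_frobInner_le _ _
      _ ≤ ‖y‖ * (‖imbalance W‖ * ‖y‖) := by gcongr; exact frobenius_norm_mul _ _
      _ ≤ ‖y‖ * (d * ‖y‖) := by gcongr
      _ = _ := by ring
  constructor
  · intro y
    linarith [neg_le_of_abs_le (h y), hs y]
  · intro y
    linarith [le_of_abs_le (h y), hs y]

/-- The order matters: θ is fixed first to absorb the θ² terms, then g is taken small relative to θ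
to absorb g/θ, d/θ² and g/θ², where d is of order √g. -/
theorem exists_parameter_scales {δ μ c B e₁ e₂ : ℝ} (r : ℕ) (hδ : δ < 1 / 3) (he₁ : 0 < e₁)
    (he₂ : 0 < e₂) :
    ∃ θ > 0, ∃ g > 0, ∃ d, d = √(2 * g * B / μ) ∧ g ≤ 1 ∧ 2 * g * B / μ ≤ e₂ ∧
      d ≤ θ ^ 2 / 2 ∧
      3 * g * B + r * c * (6 * g / θ + g + (1 + δ) * θ ^ 2 + 2 * μ * θ ^ 2 + μ * d / 2) ≤
        (1 - δ) * e₁ ∧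
      (d + g) * 2 / θ ^ 2 ≤ (1 - 3 * δ) / 4 ∧
      3 * g * B + 12 * g * c / θ ≤ (1 - 3 * δ) / 4 * e₁ := by
  have hlim : ∀ {F : ℝ → ℝ} {b : ℝ}, Continuous F → F 0 < b → ∀ᶠ x in nhdsWithin 0 (Set.Ioi 0),
      F x ≤ b := fun hF hb =>
    ((hF.tendsto 0).mono_left nhdsWithin_le_nhds).eventually_le_const hb
  have hpos1 : 0 < (1 - δ) * e₁ / 2 := div_pos (mul_pos (by linarith) he₁) two_pos
  have hpos2 : 0 < (1 - 3 * δ) / 4 := by linarith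
  have hpos3 : 0 < (1 - 3 * δ) / 4 * e₁ := mul_pos hpos2 he₁
  obtain ⟨θ, hθ1, hθ⟩ := ((hlim (F := fun θ => r * c * ((1 + δ) * θ ^ 2 + 2 * μ * θ ^ 2))
    (b := (1 - δ) * e₁ / 2) (by fun_prop) (by simpa using hpos1)).and self_mem_nhdsWithin).exists
  have hsq : Continuous fun g : ℝ => √(2 * g * B / μ) :=
    Real.continuous_sqrt.comp (by fun_prop)
  obtain ⟨g, ⟨⟨⟨⟨⟨⟨h1, h2⟩, h3⟩, h4⟩, h5⟩, h6⟩, hg⟩⟩ :=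
    (((((((hlim (F := fun g => g) (b := 1) (by fun_prop) (by simp)).and
    (hlim (F := fun g => 2 * g * B / μ) (b := e₂) (by fun_prop) (by simpa using he₂))).and
    (hlim (F := fun g => √(2 * g * B / μ)) (b := θ ^ 2 / 2) hsq (by simpa using pow_pos hθ 2))).and
    (hlim (F := fun g => 3 * g * B + r * c * (6 * g / θ + g + μ * √(2 * g * B / μ) / 2))
      (b := (1 - δ) * e₁ / 2) (by fun_prop) (by simpa using hpos1))).and
    (hlim (F := fun g => (√(2 * g * B / μ) + g) * 2 / θ ^ 2) (b := (1 - 3 * δ) / 4)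
      (by fun_prop) (by simpa using hpos2))).and
    (hlim (F := fun g => 3 * g * B + 12 * g * c / θ) (b := (1 - 3 * δ) / 4 * e₁)
      (by fun_prop) (by simpa using hpos3))).and self_mem_nhdsWithin).exists
  exact ⟨θ, hθ, g, hg, _, rfl, h1, h2, h3, by linarith, h5, h6⟩

theorem exists_uniform_error_bound {δ μ c e₁ e₂ : ℝ} {r : ℕ} (hr : 1 ≤ r) (hδ0 : 0 ≤ δ)
    (hδ : δ < 1 / 3) (hμ : 0 < μ) (he₁ : 0 < e₁) (he₂ : 0 < e₂) :
    ∃ g > 0, ∀ (n m : ℕ) (f : Matrix (Fin n) (Fin m) ℝ → ℝ) (N : Matrix (Fin n) (Fin m) ℝ)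
      (W : FactorSpace n m r), ContDiff ℝ 2 f → RIP f r r δ → IsCriticalPoint f N → N.rank ≤ r →
      ‖N‖ = c → ‖gradient (rho r f μ) W‖ ≤ g → -g ≤ minEigenvalue (hessian (rho r f μ) W) →
      ‖upper W * (lower W)ᵀ - N‖ ^ 2 ≤ e₁ ∧ ‖imbalance W‖ ^ 2 ≤ e₂ := by
  obtain ⟨θ, hθ, g, hg, d, hd, hg1, hge₂, hdθ, hsmall, hlarge1, hlarge2⟩ :=
    exists_parameter_scales (δ := δ) (μ := μ) (c := c) (B := factorBound δ r μ c) r hδ he₁ he₂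
  refine ⟨g, hg, fun n m f N W hf hR hN hNr hc hgrad hmin => ?_⟩
  obtain ⟨hUB, hVB⟩ := norm_factors_le hR hδ hf hN hNr hμ (hgrad.trans hg1)
  rw [hc] at hUB hVB
  have himb : ‖imbalance W‖ ^ 2 ≤ 2 * g * factorBound δ r μ c / μ := by
    rw [le_div_iff₀ hμ, mul_comm]
    exact norm_sq_imbalance_le hf hμ hgrad hUB hVB
  refine ⟨?_, himb.trans hge₂⟩
  have hd0 : 0 ≤ d := hd ▸ Real.sqrt_nonneg _
  have himbd : ‖imbalance W‖ ≤ d := hd ▸ Real.le_sqrt_of_sq_le himb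
  have : Nonempty (Fin r) := ⟨⟨0, hr⟩⟩
  obtain ⟨z, hz, hzmin⟩ := exists_unit_minimizer (upper W) (lower W)
  obtain ⟨hφV, hφU⟩ := abs_fderiv_mul_le hf hμ hgrad
  have hso : ∀ (x : Matrix (Fin n) Unit ℝ) (y : Matrix (Fin m) Unit ℝ),
      -(2 * fderiv ℝ f (upper W * (lower W)ᵀ) (x * yᵀ)) ≤ g * (‖x‖ ^ 2 + ‖y‖ ^ 2) +
        (1 + δ) * ‖upper W * z * yᵀ + x * (lower W * z)ᵀ‖ ^ 2 +
        4 * μ * (‖(upper W)ᵀ * x‖ ^ 2 + ‖(lower W)ᵀ * y‖ ^ 2) +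
        μ * |‖x‖ ^ 2 - ‖y‖ ^ 2| * d := fun x y =>
    (second_order_test hR hf hμ hmin hz x y).trans (by gcongr)
  have hconv := (hR.le_of_critical hf hN hNr
    (rank_mul_transpose_le_width (upper W) (lower W))).2
  rw [map_sub] at hconv
  have hφM : fderiv ℝ f (upper W * (lower W)ᵀ) (upper W * (lower W)ᵀ) ≤
      3 * g * factorBound δ r μ c := by
    refine (le_of_abs_le (hφV (upper W))).trans ?_
    gcongr
  set φ := fderiv ℝ f (upper W * (lower W)ᵀ)
  set D := ‖upper W * (lower W)ᵀ - N‖ ^ 2 with hD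
  have hD0 : 0 ≤ D := sq_nonneg _
  rcases le_total (‖upper W * z‖ ^ 2 + ‖lower W * z‖ ^ 2) (θ ^ 2) with hs | hs
  · have h1 := neg_apply_le_of_small_singular_value hμ hδ0 hg.le hg.le hd0 hθ hφV hφU hso hs hNr
    rw [hc] at h1
    exact le_of_mul_le_mul_left (a := 1 - δ) (by linarith) (by linarith)
  · set s := ‖upper W * z‖ ^ 2 + ‖lower W * z‖ ^ 2 with hs'
    obtain ⟨hU, hV⟩ := mul_norm_sq_le_of_imbalance himbd hzmin
    obtain ⟨T, hT0, hT, h1⟩ := neg_apply_le_of_large_singular_value hg.le hθ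
      (a := (s - d) / 2) (by linarith) hU hV hφV hφU hso hs'.symm hNr
    rw [hc] at h1
    -- Here 2a = s - d ≥ θ²/2, so T ≤ 2D/θ²; the error T(d + g) uses up half of the margin (1-3δ)/2.
    have hT1 : T * (d + g) ≤ (1 - 3 * δ) / 4 * D := by
      have h2 : T ≤ 2 / θ ^ 2 * D := by
        rw [div_mul_eq_mul_div, le_div_iff₀ (by positivity)]
        nlinarith [mul_le_mul_of_nonneg_right (show θ ^ 2 / 2 ≤ s - d by linarith) hT0]
      calc T * (d + g) ≤ 2 / θ ^ 2 * D * (d + g) := by gcongr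
        _ = (d + g) * 2 / θ ^ 2 * D := by ring
        _ ≤ _ := by gcongr
    -- Write s = 2a + d, use 2aT ≤ D, and absorb the rest by (1+δ)/2 ≤ 1.
    have hT2 : T * ((1 + δ) * s / 2 + g) ≤ (1 + δ) / 2 * D + T * (d + g) := by
      have h2 := mul_le_mul_of_nonneg_left hT (by linarith : 0 ≤ (1 + δ) / 2)
      have h3 : 0 ≤ T * d * ((1 - δ) / 2) :=
        mul_nonneg (mul_nonneg hT0 hd0) (by linarith)
      nlinarith
    have h2 : (1 - 3 * δ) / 4 * D ≤ (1 - 3 * δ) / 4 * e₁ := by linarith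
    exact le_of_mul_le_mul_left h2 (by linarith)

theorem infEDist_globalMinima_le {n m r : ℕ} {f : Matrix (Fin n) (Fin m) ℝ → ℝ} {δ μ α : ℝ}
    {N : Matrix (Fin n) (Fin m) ℝ} {W : FactorSpace n m r} (hf : ContDiff ℝ 2 f)
    (hR : RIP f r r δ) (hN : IsCriticalPoint f N) (hNr : N.rank ≤ r) (hμ : 0 < μ) (hα : 0 < α)
    (h : 2 * r * (4 * ‖upper W * (lower W)ᵀ - N‖ ^ 2 + ‖imbalance W‖ ^ 2) ≤ α ^ 4) :
    Metric.infEDist W (globalMinima Set.univ (rho r f μ)) ≤ ENNReal.ofReal α := by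
  obtain ⟨X, Y, hXY, hbal⟩ := exists_balanced_factorization N hNr
  obtain ⟨R, hR1, hR2, hdist⟩ := exists_orthogonal_factor_distance_le (upper W) X (lower W) Y hbal
  rw [hXY, Fintype.card_fin] at hdist
  have hmem : factorPair (X * R) (Y * R) ∈ globalMinima Set.univ (rho r f μ) := by
    refine ⟨Set.mem_univ _, fun W' _ => ?_⟩
    have h1 : rho r f μ (factorPair (X * R) (Y * R)) = f N := by
      have e1 : X * R * (Y * R)ᵀ = N := by
        rw [transpose_mul, Matrix.mul_assoc, ← Matrix.mul_assoc R, hR2, Matrix.one_mul, hXY]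
      have e2 : (X * R)ᵀ * (X * R) - (Y * R)ᵀ * (Y * R) = 0 := by
        rw [transpose_mul, transpose_mul, Matrix.mul_assoc, Matrix.mul_assoc,
          ← Matrix.mul_assoc Xᵀ, ← Matrix.mul_assoc Yᵀ, hbal, sub_self]
      rw [rho, upper_factorPair, lower_factorPair, e1, e2]
      simp
    rw [h1, rho]
    have h2 := (hR.le_of_critical hf hN hNr
      (rank_mul_transpose_le_width (upper W') (lower W'))).1
    have h3 : 0 ≤ μ / 4 * ‖(upper W')ᵀ * upper W' - (lower W')ᵀ * lower W'‖ ^ 2 := by positivity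
    linarith
  refine (Metric.infEDist_le_edist_of_mem hmem).trans ?_
  rw [edist_dist, dist_eq_norm]
  refine ENNReal.ofReal_le_ofReal ?_
  have h1 : (‖W - factorPair (X * R) (Y * R)‖ ^ 2) ^ 2 ≤ (α ^ 2) ^ 2 := by
    rw [factorSpace_norm_sq, upper_sub, lower_sub, upper_factorPair, lower_factorPair]
    refine (hdist.trans h).trans_eq ?_
    ring
  exact le_of_sq_le_sq (le_of_sq_le_sq h1 (by positivity)) hα.le

/-- The conditions on the parameters come after g, so that g can be chosen as a total function; it
is 1 at irrelevant parameters. The matrices and their sizes are quantified last, so g does not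
depend on them. -/
theorem exists_uniform_strict_saddle (δ : ℝ) (r : ℕ) (μ c α : ℝ) :
    ∃ g > 0, 1 ≤ r → 0 ≤ δ → δ < 1 / 3 → 0 < μ → 0 < α →
      ∀ (n m : ℕ) (f : Matrix (Fin n) (Fin m) ℝ → ℝ) (N : Matrix (Fin n) (Fin m) ℝ)
        (W : FactorSpace n m r), ContDiff ℝ 2 f → RIP f r r δ → IsCriticalPoint f N →
        N.rank ≤ r → ‖N‖ = c →
        Metric.infEDist W (globalMinima Set.univ (rho r f μ)) ≤ ENNReal.ofReal α ∨
        g ≤ ‖gradient (rho r f μ) W‖ ∨ minEigenvalue (hessian (rho r f μ) W) ≤ -g := by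
  by_cases h : 1 ≤ r ∧ 0 ≤ δ ∧ δ < 1 / 3 ∧ 0 < μ ∧ 0 < α
  · obtain ⟨hr, hδ0, hδ, hμ, hα⟩ := h
    have hr' : (0 : ℝ) < r := by exact_mod_cast hr
    -- Each of 2r·4e₁ and 2r·e₂ equals α⁴/2, as the Procrustes bound requires.
    obtain ⟨g, hg, hbound⟩ := exists_uniform_error_bound (c := c) (e₁ := α ^ 4 / (16 * r))
      (e₂ := α ^ 4 / (4 * r)) hr hδ0 hδ hμ (by positivity) (by positivity)
    refine ⟨g, hg, fun _ _ _ _ _ n m f N W hf hR hN hNr hc => ?_⟩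
    by_contra! hcon
    obtain ⟨h1, h2, h3⟩ := hcon
    obtain ⟨hD, hΔ⟩ := hbound n m f N W hf hR hN hNr hc h2.le h3.le
    refine h1.not_ge (infEDist_globalMinima_le hf hR hN hNr hμ hα ?_)
    calc _ ≤ 2 * r * (4 * (α ^ 4 / (16 * r)) + α ^ 4 / (4 * r)) := by gcongr
      _ = α ^ 4 := by field_simp; ring
  · exact ⟨1, one_pos, fun h1 h2 h3 h4 h5 => absurd ⟨h1, h2, h3, h4, h5⟩ h⟩

end UniformBound

end LinearAlgebraAndCalculus

/-! ### The strict saddle property. -/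

theorem mainTheorem6 :
    ∃ ε₁ lam₁ : ℝ → ℕ → ℝ → ℝ → ℝ → ℝ → ℝ,
      ∀ (n m r : ℕ) (f : Matrix (Fin n) (Fin m) ℝ → ℝ) (Mstar : Matrix (Fin n) (Fin m) ℝ)
        (δ μ α : ℝ),
        1 ≤ r →
        ContDiff ℝ 2 f →
        RIP f r r δ →
        δ < 1 / 3 →
        IsCriticalPoint f Mstar →
        Mstar.rank = r →
        0 < α →
        μ ∈ Set.Ico ((1 - δ) / 3) (1 - δ) →
        0 < ε₁ δ r μ (sigma r Mstar) ‖Mstar‖ α ∧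
        0 < lam₁ δ r μ (sigma r Mstar) ‖Mstar‖ α ∧
        ∀ ε ∈ Set.Ioc 0 (ε₁ δ r μ (sigma r Mstar) ‖Mstar‖ α),
        ∀ lam ∈ Set.Ioc 0 (lam₁ δ r μ (sigma r Mstar) ‖Mstar‖ α),
          StrictSaddle Set.univ (rho r f μ) α (min (μ * (ε / r) ^ (3 / 2 : ℝ)) lam) (μ * ε) := by
  choose g hg hsaddle using exists_uniform_strict_saddle
  -- The division by μ makes γ = με at most g; for β it is enough that the minimum is at most λ ≤ g.
  refine ⟨fun δ r μ _ c α => g δ r μ c α / μ, fun δ r μ _ c α => g δ r μ c α, ?_⟩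
  intro n m r f N δ μ α hr hf hR hδ hN hNr hα hμ
  have hμ0 : 0 < μ := by linarith [hμ.1]
  have hr' : (0 : ℝ) < r := by exact_mod_cast hr
  refine ⟨div_pos (hg _ _ _ _ _) hμ0, hg _ _ _ _ _, fun ε hε lam hlam => ⟨hα, ?_, ?_, ?_⟩⟩
  · exact lt_min (mul_pos hμ0 (Real.rpow_pos_of_pos (div_pos hε.1 hr') _)) hlam.1
  · exact mul_pos hμ0 hε.1
  · intro W _
    have hεg : μ * ε ≤ g δ r μ ‖N‖ α := by
      have := (le_div_iff₀ hμ0).1 hε.2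
      linarith
    rcases hsaddle δ r μ ‖N‖ α hr hR.1 hδ hμ0 hα n m f N W hf hR hN hNr.le rfl with h | h | h
    · exact Or.inl h
    · exact Or.inr (Or.inl (((min_le_right _ _).trans hlam.2).trans h))
    · exact Or.inr (Or.inr (h.trans (neg_le_neg hεg)))
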